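/- **Theorem.** Let $n\ge 0$ and let $M$ be an orientable smooth manifold (Hausdorff, second countable, without boundary) of dimension $2n+1$. The following assertions are equivalent. 1. $M$ admits an almost contact metric structure: there are a smooth $(1,1)$-tensor field $\phi$, a smooth vector field $\xi$, a smooth $1$-form $\eta$ and a Riemannian metric $g$ on $M$ with $$\eta(\xi)=1,\qquad \phi^2=-\mathrm{Id}+\eta\otimes\xi,\qquad g(\phi X,\phi Y)=g(X,Y)-\eta(X)\eta(Y)$$ for all vector fields $X,Y$. 2. There exist a Riemannian metric $g$ on $M$, a smooth affine connection $\nabla$ on $M$ (possibly with torsion) that is self-dual with respect to $g$, and a smooth $(1,1)$-tensor field $\theta$ that is skew-symmetric with respect to $g$ (that is, $g(\theta X,Y)=-g(X,\theta Y)$), has rank $2n$ at every point, and solves the gauge equation of $\nabla$. Here the dual connection $\nabla^*$ of $\nabla$ is defined by $Z\,g(X,Y)=g(\nabla_ZX,Y)+g(X,\nabla^*_ZY)$, self-dual means $\nabla^*=\nabla$ (equivalently $\nabla g=0$), and the gauge equation is $\nabla^*_X(\theta Y)=\theta(\nabla_XY)$ for all vector fields $X,Y$, which for $\nabla^*=\nabla$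 says $\nabla\theta=0$. -/

import Mathlib

open Bundle
open scoped Manifold ContDiff

namespace AlmostContact

section Defs

variable (m : ℕ) (M : Type*) [TopologicalSpace M]
  [ChartedSpace (EuclideanSpace ℝ (Fin m)) M]

/-- `M` is orientable: it is covered by a family of smooth charts whose transition maps all have
positive Jacobian determinant. -/
def Orientable : Prop :=
  ∃ A : Set (OpenPartialHomeomorph M (EuclideanSpace ℝ (Fin m))),
    A ⊆ IsManifold.maximalAtlas (𝓡 m) ∞ M ∧
    (∀ p : M, ∃ e ∈ A, p ∈ e.source) ∧
    ∀ e ∈ A, ∀ e' ∈ A, ∀ u ∈ (e.symm.trans e').source,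
      0 < (fderiv ℝ (e.symm.trans e') u).det

variable [IsManifold (𝓡 m) ∞ M]

/-- Smooth vector fields on `M`. -/
abbrev VectorField : Type _ :=
  ContMDiffSection (𝓡 m) (EuclideanSpace ℝ (Fin m)) ∞ (fun x : M ↦ TangentSpace (𝓡 m) x)

/-- Smooth `1`-forms on `M`. -/
abbrev OneForm : Type _ :=
  ContMDiffSection (𝓡 m) (EuclideanSpace ℝ (Fin m) →L[ℝ] ℝ) ∞
    (fun x : M ↦ TangentSpace (𝓡 m) x →L[ℝ] Bundle.Trivial M ℝ x)

/-- Smooth `(1,1)`-tensor fields on `M`, i.e. smooth fields of endomorphisms of the tangent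
spaces. -/
abbrev EndoField : Type _ :=
  ContMDiffSection (𝓡 m) (EuclideanSpace ℝ (Fin m) →L[ℝ] EuclideanSpace ℝ (Fin m)) ∞
    (fun x : M ↦ TangentSpace (𝓡 m) x →L[ℝ] TangentSpace (𝓡 m) x)

/-- Smooth Riemannian metrics on `M`. -/
abbrev Metric : Type _ :=
  ContMDiffRiemannianMetric (𝓡 m) ∞ (EuclideanSpace ℝ (Fin m))
    (fun x : M ↦ TangentSpace (𝓡 m) x)

/-- Affine connections on `M`, possibly with torsion: covariant derivatives on the tangent bundle.
Note the argument order: `D Y x (X x)` is the value of `∇_X Y` at `x`. Smoothness is the additional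
condition `D.ContMDiffCovariantDerivative ∞`. -/
abbrev Connection : Type _ :=
  CovariantDerivative (𝓡 m) (EuclideanSpace ℝ (Fin m)) (fun x : M ↦ TangentSpace (𝓡 m) x)

/-- An almost contact metric structure `(φ, ξ, η, g)` on `M`. -/
structure MetricStructure where
  φ : EndoField m M
  ξ : VectorField m M
  η : OneForm m M
  g : Metric m M
  eta_xi : ∀ x, η x (ξ x) = (1 : ℝ)
  phi_sq : ∀ x (v : TangentSpace (𝓡 m) x), φ x (φ x v) = -v + (η x v : ℝ) • ξ x
  compatible : ∀ x (v w : TangentSpace (𝓡 m) x),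
    g.inner x (φ x v) (φ x w) = g.inner x v w - (η x v : ℝ) * (η x w : ℝ)

variable {m M}

/-- `D'` is dual to `D` with respect to `g`: for all smooth vector fields `X, Y, Z`,
`Z (g(X, Y)) = g(D_Z X, Y) + g(X, D'_Z Y)`. -/
def IsDual (g : Metric m M) (D D' : Connection m M) : Prop :=
  ∀ (X Y Z : VectorField m M) (x : M),
    mvfderiv (𝓡 m) (fun y ↦ g.inner y (X y) (Y y)) x (Z x) =
      g.inner x (D X x (Z x)) (Y x) + g.inner x (X x) (D' Y x (Z x))

/-- `D` is its own dual with respect to `g`, i.e. `D` is a metric connection. -/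
def IsSelfDual (g : Metric m M) (D : Connection m M) : Prop := IsDual g D D

/-- `θ` solves the gauge equation of the pair of connections `(D, D')`: for all smooth vector
fields `X, Y`, `D'_X (θ Y) = θ (D_X Y)`. -/
def GaugeEquation (D D' : Connection m M) (θ : EndoField m M) : Prop :=
  ∀ (X Y : VectorField m M) (x : M),
    D' (fun y ↦ θ y (Y y)) x (X x) = θ x (D Y x (X x))

/-- `θ` is skew-symmetric with respect to `g`. -/
def IsSkew (g : Metric m M) (θ : EndoField m M) : Prop :=
  ∀ (x : M) (v w : TangentSpace (𝓡 m) x), g.inner x (θ x v) w = -g.inner x v (θ x w)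

/-- `θ` has rank `r` at every point. -/
def HasRank (θ : EndoField m M) (r : ℕ) : Prop :=
  ∀ x : M, Module.finrank ℝ (LinearMap.range (θ x).toLinearMap) = r

end Defs

end AlmostContact

/-! From 1 to 2: `F = φ + η ⊗ ξ` is an isometry with `F⁴ = 1`, and `φ = F - (F² + 1)/2`, so a metric
connection commuting with `F` makes `φ` parallel. Such a connection comes from a Parseval family, a
locally finite family of fields `e i` with `∑ g(v, e i) e i = v`: the formula `∇Y = ∑ d(g(Y, e i)) ⊗
e i` defines a metric connection for which every isometry permuting the `e i` is parallel. Local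
orthonormal frames, weighted by functions whose squares sum to 1, form a Parseval family
(`exists_isParseval`); its translates by the powers of `F`, halved, form one that `F` permutes
(`exists_isParseval_invariant`).

From 2 to 1: `φ` is the orthogonal factor in the polar decomposition of `θ`, extended by zero on
`ker θ`. At one point it is an odd polynomial `θ f(-θ²)`, where `f` interpolates `μ ↦ μ^(-1/2)` at
the eigenvalues of `-θ²`. That a given `f` works is an identity `P(θ) = 0` with `P` odd. Then `P(θ)`
is skew, so the identity is equivalent to `tr P(θ)² = 0`, and traces of polynomials in a parallel
`θ` are locally constant. Hence one `f` serves a whole connected component, and `φ` is smooth with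
`φ³ = -φ` and `ker φ = ker θ` a line field. Modulo that line `φ` is a complex structure, which
orients the quotient (`det_adaptedFamily_mul_nonneg`). The orientation of `M` therefore singles out
an open half-line in each `ker φ`. Half-lines are convex, so a partition of unity yields a nowhere
vanishing section; normalized to `ξ`, and with `η = g(ξ, ·)`, it completes `φ` to an almost contact
metric structure. -/

namespace AlmostContact

open Topology

/-! ### Extension of local vector fields and smoothness criteria. -/

section Smoothness

variable {m : ℕ} {M : Type*} [TopologicalSpace M]
  [ChartedSpace (EuclideanSpace ℝ (Fin m)) M] [IsManifold (𝓡 m) ∞ M]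

/-- Smoothness of a vector field on a set. -/
abbrev SmoothOn (X : Π x : M, TangentSpace (𝓡 m) x) (U : Set M) : Prop :=
  ContMDiffOn (𝓡 m) ((𝓡 m).prod 𝓘(ℝ, EuclideanSpace ℝ (Fin m))) ∞
    (fun x ↦ TotalSpace.mk' (EuclideanSpace ℝ (Fin m)) x (X x)) U

/-- Smoothness of a vector field. -/
abbrev Smooth (X : Π x : M, TangentSpace (𝓡 m) x) : Prop :=
  ContMDiff (𝓡 m) ((𝓡 m).prod 𝓘(ℝ, EuclideanSpace ℝ (Fin m))) ∞
    (fun x ↦ TotalSpace.mk' (EuclideanSpace ℝ (Fin m)) x (X x))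

/-- Differentiability of a vector field at a point. -/
abbrev DiffAt (X : Π x : M, TangentSpace (𝓡 m) x) (p : M) : Prop :=
  MDifferentiableAt (𝓡 m) ((𝓡 m).prod 𝓘(ℝ, EuclideanSpace ℝ (Fin m)))
    (fun x ↦ TotalSpace.mk' (EuclideanSpace ℝ (Fin m)) x (X x)) p

/-- A local smooth vector field agrees near a given point with a global one. -/
lemma exists_vectorField_eventuallyEq [SigmaCompactSpace M] [T2Space M] {p : M} {U : Set M}
    (hU : U ∈ 𝓝 p) {s : Π x : M, TangentSpace (𝓡 m) x} (hs : SmoothOn s U) :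
    ∃ X : VectorField m M, ∀ᶠ x in 𝓝 p, X x = s x := by
  have : LocallyCompactSpace M := ChartedSpace.locallyCompactSpace (EuclideanSpace ℝ (Fin m)) M
  obtain ⟨K, hKp, hKc, hKU⟩ := exists_mem_nhds_isClosed_subset (interior_mem_nhds.2 hU)
  -- The constraint is a single point over the closed neighbourhood `K` and void elsewhere, so it is
  -- convex; `s` and the zero section solve it locally.
  obtain ⟨X, hX⟩ := exists_contMDiffSection_forall_mem_convex_of_local (n := ⊤) (𝓡 m)
    (fun x : M ↦ TangentSpace (𝓡 m) x) (fun x ↦ {v | x ∈ K → v = s x})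
    (fun x v hv w hw a b _ _ hab hx ↦ by
      rw [hv hx, hw hx, ← add_smul, hab, one_smul])
    (fun x₀ ↦ by
      by_cases hx : x₀ ∈ K
      · exact ⟨U, mem_interior_iff_mem_nhds.1 (hKU hx), s, hs, fun y _ _ ↦ rfl⟩
      · exact ⟨Kᶜ, hKc.isOpen_compl.mem_nhds hx, fun _ ↦ 0,
          (contMDiff_zeroSection ℝ (fun x : M ↦ TangentSpace (𝓡 m) x)).contMDiffOn,
          fun y hy hy' ↦ absurd hy' hy⟩)
  exact ⟨X, Filter.mem_of_superset hKp fun x hx ↦ hX x hx⟩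

/-- Every tangent vector is the value of a global smooth vector field. -/
lemma exists_vectorField_apply_eq [SigmaCompactSpace M] [T2Space M] (p : M)
    (v : TangentSpace (𝓡 m) p) : ∃ X : VectorField m M, X p = v := by
  obtain ⟨U, hU, hs⟩ := FiberBundle.exists_contMDiffOn_extend (k := ∞) (𝓡 m)
    (EuclideanSpace ℝ (Fin m)) (V := fun x : M ↦ TangentSpace (𝓡 m) x) v
  obtain ⟨X, hX⟩ := exists_vectorField_eventuallyEq (m := m) hU hs
  exact ⟨X, by simpa using hX.self_of_nhds⟩

lemma contMDiff_inner (g : Metric m M) {X Y : Π x : M, TangentSpace (𝓡 m) x}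
    (hX : Smooth X) (hY : Smooth Y) :
    ContMDiff (𝓡 m) 𝓘(ℝ) ∞ (fun x ↦ g.inner x (X x) (Y x)) := by
  intro x
  have : ContMDiffAt (𝓡 m) ((𝓡 m).prod 𝓘(ℝ)) ∞
      (fun y ↦ TotalSpace.mk' ℝ (E := Bundle.Trivial M ℝ) y (g.inner y (X y) (Y y))) x :=
    ContMDiffAt.clm_bundle_apply₂ (F₁ := EuclideanSpace ℝ (Fin m))
      (F₂ := EuclideanSpace ℝ (Fin m)) g.contMDiff.contMDiffAt (hX x) (hY x)
  exact (contMDiffAt_totalSpace.1 this).2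

lemma mdifferentiableAt_inner (g : Metric m M) {X Y : Π x : M, TangentSpace (𝓡 m) x} {x : M}
    (hX : DiffAt X x) (hY : DiffAt Y x) :
    MDifferentiableAt (𝓡 m) 𝓘(ℝ) (fun x ↦ g.inner x (X x) (Y x)) x := by
  have : MDifferentiableAt (𝓡 m) ((𝓡 m).prod 𝓘(ℝ))
      (fun y ↦ TotalSpace.mk' ℝ (E := Bundle.Trivial M ℝ) y (g.inner y (X y) (Y y))) x :=
    MDifferentiableAt.clm_bundle_apply₂ (F₁ := EuclideanSpace ℝ (Fin m))
      (F₂ := EuclideanSpace ℝ (Fin m)) (g.contMDiff.contMDiffAt.mdifferentiableAt (by simp)) hX hY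
  exact ((mdifferentiableAt_totalSpace ..).1 this).2

lemma contMDiff_mvfderiv_apply {f : M → ℝ} (hf : ContMDiff (𝓡 m) 𝓘(ℝ) ∞ f)
    {X : Π x : M, TangentSpace (𝓡 m) x} (hX : Smooth X) :
    ContMDiff (𝓡 m) 𝓘(ℝ) ∞ (fun x ↦ mvfderiv (𝓡 m) f x (X x)) := by
  have h1 : ContMDiff (𝓡 m).tangent 𝓘(ℝ, ℝ).tangent ∞ (tangentMap (𝓡 m) 𝓘(ℝ, ℝ) f) :=
    hf.contMDiff_tangentMap (by simp)
  exact (contMDiff_snd_tangentBundle_modelSpace ℝ 𝓘(ℝ, ℝ)).comp (h1.comp hX)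

/-- A field of linear maps out of the tangent spaces is smooth if it maps smooth vector fields to
smooth sections. -/
lemma contMDiff_hom_of_apply [SigmaCompactSpace M] [T2Space M]
    {F : Type*} [NormedAddCommGroup F] [NormedSpace ℝ F]
    {V : M → Type*} [TopologicalSpace (TotalSpace F V)]
    [∀ x, AddCommGroup (V x)] [∀ x, Module ℝ (V x)] [∀ x : M, TopologicalSpace (V x)]
    [∀ x, IsTopologicalAddGroup (V x)] [∀ x, ContinuousSMul ℝ (V x)]
    [FiberBundle F V] [VectorBundle ℝ F V]
    (A : Π x : M, TangentSpace (𝓡 m) x →L[ℝ] V x)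
    (hA : ∀ X : VectorField m M, ContMDiff (𝓡 m) ((𝓡 m).prod 𝓘(ℝ, F)) ∞
      (fun x ↦ TotalSpace.mk' F x (A x (X x)))) :
    ContMDiff (𝓡 m) ((𝓡 m).prod 𝓘(ℝ, EuclideanSpace ℝ (Fin m) →L[ℝ] F)) ∞
      (fun x ↦ TotalSpace.mk' (EuclideanSpace ℝ (Fin m) →L[ℝ] F)
        (E := fun x : M ↦ TangentSpace (𝓡 m) x →L[ℝ] V x) x (A x)) := by
  intro p
  rw [contMDiffAt_hom_bundle]
  refine ⟨contMDiffAt_id, ?_⟩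
  set E := EuclideanSpace ℝ (Fin m)
  let b := Module.finBasis ℝ E
  let t := trivializationAt E (fun x : M ↦ TangentSpace (𝓡 m) x) p
  let L (i) : F →L[ℝ] (E →L[ℝ] F) :=
    ContinuousLinearMap.smulRightL ℝ E F (LinearMap.toContinuousLinearMap (b.coord i))
  have key (i) : ContMDiffAt (𝓡 m) 𝓘(ℝ, F) ∞ (fun x ↦ ContinuousLinearMap.inCoordinates E
      (fun x : M ↦ TangentSpace (𝓡 m) x) F V p x p x (A x) (b i)) p := by
    have hp : t.baseSet ∈ 𝓝 p := t.open_baseSet.mem_nhds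
      (FiberBundle.mem_baseSet_trivializationAt' p)
    -- The columns of `A` in coordinates are its values on the local frame, and each frame field
    -- agrees near `p` with a global one, to which `hA` applies.
    obtain ⟨X, hX⟩ := exists_vectorField_eventuallyEq (m := m) hp
      (t.contMDiffOn_localFrame_baseSet (I := 𝓡 m) ∞ b i)
    have h2 := ((contMDiffAt_totalSpace.1 (hA X p)).2)
    refine h2.congr_of_eventuallyEq ?_
    have hV : (trivializationAt F V p).baseSet ∈ 𝓝 p :=
      (trivializationAt F V p).open_baseSet.mem_nhds (FiberBundle.mem_baseSet_trivializationAt' p)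
    filter_upwards [hX, hp, hV] with x hx hxp hxV
    rw [ContinuousLinearMap.inCoordinates_eq hxp hxV, hx]
    simp only [ContinuousLinearMap.comp_apply]
    rw [Trivialization.localFrame_apply_of_mem_baseSet (hx := hxp)]
    rfl
  have := ContMDiffAt.sum (t := Finset.univ) fun i _ ↦ (L i).contMDiff.contMDiffAt.comp p (key i)
  refine this.congr_of_eventuallyEq (Filter.Eventually.of_forall fun x ↦ ?_)
  refine ContinuousLinearMap.ext fun v ↦ ?_
  conv_lhs => rw [← b.sum_repr v, map_sum]
  simp only [map_smul]
  simp [L]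
  rfl

/-- The smooth vector field obtained by applying a field of endomorphisms to a vector field. -/
noncomputable def EndoField.app (θ : EndoField m M) (X : VectorField m M) : VectorField m M where
  toFun x := θ x (X x)
  contMDiff_toFun := ContMDiff.clm_bundle_apply (F₁ := EuclideanSpace ℝ (Fin m))
    (F₂ := EuclideanSpace ℝ (Fin m)) θ.contMDiff X.contMDiff

@[simp] lemma EndoField.app_apply (θ : EndoField m M) (X : VectorField m M) (x : M) :
    θ.app X x = θ x (X x) := rfl

/-- The product of a smooth function and a smooth vector field. -/
noncomputable def smulField (f : M → ℝ) (hf : ContMDiff (𝓡 m) 𝓘(ℝ) ∞ f) (X : VectorField m M) :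
    VectorField m M where
  toFun x := f x • X x
  contMDiff_toFun := hf.smul_section X.contMDiff

@[simp] lemma smulField_apply (f : M → ℝ) (hf : ContMDiff (𝓡 m) 𝓘(ℝ) ∞ f)
    (X : VectorField m M) (x : M) : smulField f hf X x = f x • X x := rfl

/-- A field of endomorphisms is smooth if it maps smooth vector fields to smooth vector fields. -/
noncomputable def EndoField.ofApply [SigmaCompactSpace M] [T2Space M]
    (A : Π x : M, TangentSpace (𝓡 m) x →L[ℝ] TangentSpace (𝓡 m) x)
    (hA : ∀ X : VectorField m M, Smooth (fun x ↦ A x (X x))) : EndoField m M where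
  toFun := A
  contMDiff_toFun := contMDiff_hom_of_apply A hA

/-- The `1`-form dual to a vector field. -/
noncomputable def OneForm.ofInner [SigmaCompactSpace M] [T2Space M] (g : Metric m M)
    (ξ : VectorField m M) : OneForm m M where
  toFun x := g.inner x (ξ x)
  contMDiff_toFun := contMDiff_hom_of_apply (V := Bundle.Trivial M ℝ) (fun x ↦ g.inner x (ξ x))
    fun X x ↦ contMDiffAt_totalSpace.2
      ⟨contMDiffAt_id, contMDiff_inner g ξ.contMDiff X.contMDiff x⟩

@[simp] lemma OneForm.ofInner_apply [SigmaCompactSpace M] [T2Space M] (g : Metric m M)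
    (ξ : VectorField m M) (x : M) (v : TangentSpace (𝓡 m) x) :
    OneForm.ofInner g ξ x v = g.inner x (ξ x) v := rfl

lemma OneForm.contMDiff_apply (η : OneForm m M) (X : VectorField m M) :
    ContMDiff (𝓡 m) 𝓘(ℝ) ∞ (fun x ↦ (η x (X x) : ℝ)) := by
  intro x
  have : ContMDiffAt (𝓡 m) ((𝓡 m).prod 𝓘(ℝ)) ∞
      (fun y ↦ TotalSpace.mk' ℝ (E := Bundle.Trivial M ℝ) y (η y (X y))) x :=
    ContMDiffAt.clm_bundle_apply (F₁ := EuclideanSpace ℝ (Fin m)) (F₂ := ℝ)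
      η.contMDiff.contMDiffAt X.contMDiff.contMDiffAt
  exact (contMDiffAt_totalSpace.1 this).2

lemma VectorField.ext' {X Y : VectorField m M} (h : ∀ x, X x = Y x) : X = Y :=
  ContMDiffSection.ext h

lemma VectorField.sum_apply {ι : Type*} (s : Finset ι) (X : ι → VectorField m M) (x : M) :
    (∑ i ∈ s, X i) x = ∑ i ∈ s, X i x := by
  have := congrFun (map_sum (ContMDiffSection.coeAddHom (𝓡 m) (EuclideanSpace ℝ (Fin m)) ∞
    (fun x : M ↦ TangentSpace (𝓡 m) x)) X s) x
  rwa [Finset.sum_apply] at this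

end Smoothness

/-! ### Orthonormal families in a vector space. -/

section LinearAlgebra

/-- Locally finite sums may thus be computed over whichever finite index set is convenient. -/
lemma sum_eq_sum_of_forall_notMem {ι V : Type*} [AddCommMonoid V] {s t : Finset ι} {f : ι → V}
    (hs : ∀ i ∉ s, f i = 0) (ht : ∀ i ∉ t, f i = 0) : ∑ i ∈ s, f i = ∑ i ∈ t, f i := by
  classical
  exact (Finset.sum_subset (Finset.subset_union_left (s₂ := t)) fun i _ hi ↦ hs i hi).trans
    (Finset.sum_subset (Finset.subset_union_right (s₁ := s)) fun i _ hi ↦ ht i hi).symm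

variable {V : Type*} [AddCommGroup V] [Module ℝ V] {m : ℕ}

/-- An orthonormal family of the right cardinality spans. -/
lemma sum_smul_eq_of_orthonormal [FiniteDimensional ℝ V]
    (hV : Module.finrank ℝ V = m) (B : V →ₗ[ℝ] V →ₗ[ℝ] ℝ)
    {e : Fin m → V} (he : ∀ i j, B (e i) (e j) = if i = j then 1 else 0) (v : V) :
    ∑ i, B v (e i) • e i = v := by
  have hli : LinearIndependent ℝ e := by
    rw [Fintype.linearIndependent_iff]
    intro c hc i
    have : B (∑ j, c j • e j) (e i) = 0 := by rw [hc]; simp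
    simpa [he] using this
  have hcard : Fintype.card (Fin m) = Module.finrank ℝ V := by simp [hV]
  have hmem : v ∈ Submodule.span ℝ (Set.range e) := by
    rw [hli.span_eq_top_of_card_eq_finrank' hcard]; trivial
  obtain ⟨c, rfl⟩ := (Submodule.mem_span_range_iff_exists_fun ℝ).1 hmem
  refine Finset.sum_congr rfl fun i _ ↦ ?_
  simp [he]

/-- A family of fewer vectors than the dimension has a unit normal vector. -/
lemma exists_unit_orthogonal [FiniteDimensional ℝ V] {k : ℕ} (hk : k < Module.finrank ℝ V)
    (B : V →ₗ[ℝ] V →ₗ[ℝ] ℝ) (hp : ∀ v, v ≠ 0 → 0 < B v v) (e : Fin k → V) :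
    ∃ v, B v v = 1 ∧ ∀ i, B v (e i) = 0 := by
  let f : V →ₗ[ℝ] (Fin k → ℝ) := LinearMap.pi fun i ↦ B.flip (e i)
  obtain ⟨v, hv, hv0⟩ := Submodule.exists_mem_ne_zero_of_ne_bot
    (LinearMap.ker_ne_bot_of_finrank_lt (f := f) (by simpa using hk))
  have hv' : ∀ i, B v (e i) = 0 := fun i ↦ congrFun (LinearMap.mem_ker.1 hv) i
  refine ⟨(Real.sqrt (B v v))⁻¹ • v, ?_, fun i ↦ by simp [hv']⟩
  have h1 := hp v hv0
  have h2 : Real.sqrt (B v v) ≠ 0 := (Real.sqrt_pos.2 h1).ne'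
  simp only [map_smul, LinearMap.smul_apply, smul_eq_mul]
  field_simp
  rw [Real.sq_sqrt h1.le]

end LinearAlgebra

section TangentSpace

variable {m : ℕ} {M : Type*} [TopologicalSpace M] [ChartedSpace (EuclideanSpace ℝ (Fin m)) M]

instance finiteDimensional_tangentSpace (x : M) :
    FiniteDimensional ℝ (TangentSpace (𝓡 m) x) :=
  inferInstanceAs (FiniteDimensional ℝ (EuclideanSpace ℝ (Fin m)))

lemma finrank_tangentSpace (x : M) : Module.finrank ℝ (TangentSpace (𝓡 m) x) = m :=
  finrank_euclideanSpace_fin (𝕜 := ℝ) (n := m)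

end TangentSpace

/-! ### Local orthonormal frames and Parseval families. -/

section Frames

variable {m : ℕ} {M : Type*} [TopologicalSpace M]
  [ChartedSpace (EuclideanSpace ℝ (Fin m)) M] [IsManifold (𝓡 m) ∞ M]

/-- The bilinear form on a tangent space given by a metric. -/
noncomputable def Metric.bilin (g : Metric m M) (x : M) :
    TangentSpace (𝓡 m) x →ₗ[ℝ] TangentSpace (𝓡 m) x →ₗ[ℝ] ℝ :=
  LinearMap.mk₂ ℝ (fun v w ↦ g.inner x v w) (by simp) (by simp) (by simp) (by simp)

@[simp] lemma Metric.bilin_apply (g : Metric m M) (x : M) (v w : TangentSpace (𝓡 m) x) :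
    g.bilin x v w = g.inner x v w := rfl

/-- A family of vector fields which is orthonormal at a point. -/
def OrthonormalAt (g : Metric m M) {k : ℕ} (E : Fin k → VectorField m M) (x : M) : Prop :=
  ∀ i j, g.inner x (E i x) (E j x) = if i = j then 1 else 0

lemma OrthonormalAt.sum_eq {g : Metric m M} {E : Fin m → VectorField m M} {x : M}
    (h : OrthonormalAt g E x) (v : TangentSpace (𝓡 m) x) :
    ∑ i, g.inner x v (E i x) • E i x = v :=
  sum_smul_eq_of_orthonormal (finrank_tangentSpace x) (g.bilin x) h v

/-- Gram–Schmidt near `p`, one field at a time. -/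
lemma exists_orthonormalAt_aux [SigmaCompactSpace M] [T2Space M] (g : Metric m M) (p : M)
    (k : ℕ) (hk : k ≤ m) :
    ∃ E : Fin k → VectorField m M, ∀ᶠ x in 𝓝 p, OrthonormalAt g E x := by
  induction k with
  | zero => exact ⟨Fin.elim0, Filter.Eventually.of_forall fun x i ↦ i.elim0⟩
  | succ k ih =>
    obtain ⟨E, hE⟩ := ih (by omega)
    obtain ⟨v, hv1, hv⟩ := exists_unit_orthogonal (by rw [finrank_tangentSpace]; omega)
      (g.bilin p) (g.pos p) (fun i : Fin k ↦ E i p)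
    simp only [Metric.bilin_apply] at hv1 hv
    obtain ⟨X, hX⟩ := exists_vectorField_apply_eq p v
    -- At `p` the correction vanishes, so `W p = v` has norm 1 and `W` can be normalized near `p`.
    let W : VectorField m M :=
      X - ∑ i, smulField _ (contMDiff_inner g X.contMDiff (E i).contMDiff) (E i)
    have hW : ∀ x, W x = X x - ∑ i, g.inner x (X x) (E i x) • E i x := fun x ↦ by
      simp [W, VectorField.sum_apply]
    let f : M → ℝ := fun x ↦ g.inner x (W x) (W x)
    have hf : ContMDiff (𝓡 m) 𝓘(ℝ) ∞ f := contMDiff_inner g W.contMDiff W.contMDiff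
    have hfp : f p = 1 := by simp [f, hW, hX, hv, hv1]
    have hU : IsOpen {x | 0 < f x} := isOpen_lt continuous_const hf.continuous
    have hpU : {x | 0 < f x} ∈ 𝓝 p := hU.mem_nhds (by simp [hfp])
    have hs : SmoothOn (fun x ↦ (Real.sqrt (f x))⁻¹ • W x) {x | 0 < f x} := by
      refine ContMDiffOn.smul_section (fun x hx ↦ ?_) W.contMDiff.contMDiffOn
      have h1 : ContDiffAt ℝ ∞ (fun y ↦ (Real.sqrt y)⁻¹) (f x) :=
        (Real.contDiffAt_sqrt (ne_of_gt hx)).inv (Real.sqrt_pos.2 hx).ne'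
      exact (h1.contMDiffAt.comp x hf.contMDiffAt).contMDiffWithinAt
    obtain ⟨Y, hY⟩ := exists_vectorField_eventuallyEq hpU hs
    refine ⟨Fin.cons Y E, ?_⟩
    filter_upwards [hE, hY, hpU] with x hEx hYx hx
    have hWE : ∀ i, g.inner x (W x) (E i x) = 0 := fun i ↦ by
      have := hEx
      simp only [OrthonormalAt] at this
      simp [hW, this]
    have hYY : g.inner x (Y x) (Y x) = 1 := by
      have h1 : 0 < g.inner x (W x) (W x) := hx
      have h2 : Real.sqrt (g.inner x (W x) (W x)) ≠ 0 := (Real.sqrt_pos.2 h1).ne'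
      simp only [hYx, map_smul, smul_apply, smul_eq_mul, f]
      field_simp
      rw [Real.sq_sqrt h1.le]
    have hYE : ∀ i, g.inner x (Y x) (E i x) = 0 := fun i ↦ by
      simp [hYx, hWE]
    have hEY : ∀ i, g.inner x (E i x) (Y x) = 0 := fun i ↦ by rw [g.symm, hYE]
    intro i j
    refine Fin.cases ?_ (fun i ↦ ?_) i <;> refine Fin.cases ?_ (fun j ↦ ?_) j
    · simpa using hYY
    · simpa [Fin.succ_ne_zero, eq_comm] using hYE j
    · simpa [Fin.succ_ne_zero] using hEY i
    · simpa using hEx i j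

lemma exists_orthonormalAt [SigmaCompactSpace M] [T2Space M] (g : Metric m M) (p : M) :
    ∃ E : Fin m → VectorField m M, ∀ᶠ x in 𝓝 p, OrthonormalAt g E x :=
  exists_orthonormalAt_aux g p m le_rfl

/-- A locally finite family of vector fields `e i` such that `∑ i, g (v, e i) e i = v` for all
tangent vectors `v`. -/
structure IsParseval (g : Metric m M) {ι : Type*} (e : ι → VectorField m M) : Prop where
  locallyFinite : ∀ p : M, ∃ s : Finset ι, ∀ᶠ x in 𝓝 p, ∀ i ∉ s, e i x = 0
  sum_eq : ∀ (x : M) (s : Finset ι), (∀ i ∉ s, e i x = 0) →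
    ∀ v : TangentSpace (𝓡 m) x, ∑ i ∈ s, g.inner x v (e i x) • e i x = v

lemma exists_isParseval [SigmaCompactSpace M] [T2Space M] (g : Metric m M) :
    ∃ e : M × Fin m → VectorField m M, IsParseval g e := by
  choose E hE using exists_orthonormalAt (m := m) g
  let U (p : M) : Set M := interior {x | OrthonormalAt g (E p) x}
  have : LocallyCompactSpace M := ChartedSpace.locallyCompactSpace (EuclideanSpace ℝ (Fin m)) M
  obtain ⟨ρ, hρ⟩ := SmoothPartitionOfUnity.exists_isSubordinate (𝓡 m) isClosed_univ U
    (fun p ↦ isOpen_interior)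
    (fun p _ ↦ Set.mem_iUnion.2 ⟨p, mem_interior_iff_mem_nhds.2 (hE p)⟩)
  have hfin (x : M) : ∃ s : Finset M, ∀ᶠ y in 𝓝 x, ∀ p ∉ s, ρ p y = 0 := by
    refine ⟨ρ.fintsupport x, ?_⟩
    filter_upwards [ρ.eventually_finsupport_subset x] with y hy p hp
    by_contra h
    exact hp (hy ((ρ.mem_finsupport y).2 h))
  -- The Parseval identity is quadratic in the weights, so `ρ` is rescaled to make the squares,
  -- rather than the functions, sum to 1.
  let N : M → ℝ := fun x ↦ ∑ᶠ p, ρ p x ^ 2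
  have hN : ContMDiff (𝓡 m) 𝓘(ℝ) ∞ N := by
    refine contMDiff_finsum (fun p ↦ (ρ p).contMDiff.pow 2) ?_
    refine ρ.locallyFinite.subset fun p x hx ↦ ?_
    simpa using hx
  have hNs (x : M) (s : Finset M) (hs : ∀ p ∉ s, ρ p x = 0) : N x = ∑ p ∈ s, ρ p x ^ 2 := by
    refine finsum_eq_sum_of_support_subset _ fun p hp ↦ ?_
    by_contra h
    exact hp (by simp [hs p h])
  have hNpos (x : M) : 0 < N x := by
    obtain ⟨s, hs⟩ := hfin x
    obtain ⟨p, hp⟩ := ρ.exists_pos_of_mem (Set.mem_univ x)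
    rw [hNs x s hs.self_of_nhds]
    refine Finset.sum_pos' (fun _ _ ↦ sq_nonneg _) ⟨p, ?_, by positivity⟩
    by_contra h
    exact hp.ne' (hs.self_of_nhds p h)
  let χ (p : M) : M → ℝ := fun x ↦ ρ p x * (Real.sqrt (N x))⁻¹
  have hχ (p : M) : ContMDiff (𝓡 m) 𝓘(ℝ) ∞ (χ p) := by
    refine (ρ p).contMDiff.mul fun x ↦ ?_
    have h1 : ContDiffAt ℝ ∞ (fun y ↦ (Real.sqrt y)⁻¹) (N x) :=
      (Real.contDiffAt_sqrt (hNpos x).ne').inv (Real.sqrt_pos.2 (hNpos x)).ne'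
    exact h1.contMDiffAt.comp x hN.contMDiffAt
  refine ⟨fun i ↦ smulField (χ i.1) (hχ i.1) (E i.1 i.2), ⟨fun x ↦ ?_, fun x s hs v ↦ ?_⟩⟩
  · obtain ⟨s, hs⟩ := hfin x
    refine ⟨s ×ˢ Finset.univ, hs.mono fun y hy i hi ↦ ?_⟩
    have : i.1 ∉ s := fun h ↦ hi (by simp [h])
    simp [χ, hy _ this]
  · classical
    obtain ⟨t, ht⟩ := hfin x
    have ht := ht.self_of_nhds
    let F : M × Fin m → TangentSpace (𝓡 m) x := fun i ↦
      g.inner x v (smulField (χ i.1) (hχ i.1) (E i.1 i.2) x) •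
        smulField (χ i.1) (hχ i.1) (E i.1 i.2) x
    have h0 : ∑ i ∈ s, F i = ∑ i ∈ t ×ˢ Finset.univ, F i := by
      refine sum_eq_sum_of_forall_notMem (fun i hi ↦ ?_) fun i hi ↦ ?_
      · simp only [F]
        rw [hs i hi, smul_zero]
      · have : i.1 ∉ t := fun h ↦ hi (by simp [h])
        simp [F, χ, ht _ this]
    change ∑ i ∈ s, F i = v
    rw [h0, Finset.sum_product]
    -- Wherever the weight is nonzero, the frame `E p` is orthonormal.
    have h1 (p : M) : ∑ j, F (p, j) = χ p x ^ 2 • v := by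
      by_cases hp : ρ p x = 0
      · simp [F, χ, hp]
      · have hx : OrthonormalAt g (E p) x :=
          interior_subset (hρ p (subset_closure (Function.mem_support.2 hp)))
        conv_rhs => rw [← hx.sum_eq v, Finset.smul_sum]
        refine Finset.sum_congr rfl fun j _ ↦ ?_
        simp only [F, smulField_apply, map_smul, smul_smul, smul_eq_mul]
        congr 1
        ring
    simp only [h1]
    rw [← Finset.sum_smul]
    have h2 : ∑ p ∈ t, χ p x ^ 2 = 1 := by
      simp only [χ, mul_pow, inv_pow, Real.sq_sqrt (hNpos x).le]
      rw [← Finset.sum_mul, ← hNs x t ht, mul_inv_cancel₀ (hNpos x).ne']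
    rw [h2, one_smul]

end Frames

/-! ### Derivatives of real functions. -/

section Calculus

variable {m : ℕ} {M : Type*} [TopologicalSpace M]
  [ChartedSpace (EuclideanSpace ℝ (Fin m)) M]

lemma mvfderiv_congr {f f' : M → ℝ} {x : M} (h : f =ᶠ[𝓝 x] f') :
    mvfderiv (𝓡 m) f x = mvfderiv (𝓡 m) f' x := by
  ext v
  simp only [mvfderiv, h.mfderiv_eq]
  rfl

lemma mvfderiv_finset_sum {ι : Type*} (s : Finset ι) {f : ι → M → ℝ} {x : M}
    (h : ∀ i ∈ s, MDifferentiableAt (𝓡 m) 𝓘(ℝ) (f i) x) :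
    MDifferentiableAt (𝓡 m) 𝓘(ℝ) (fun y ↦ ∑ i ∈ s, f i y) x ∧
    mvfderiv (𝓡 m) (fun y ↦ ∑ i ∈ s, f i y) x = ∑ i ∈ s, mvfderiv (𝓡 m) (f i) x := by
  classical
  induction s using Finset.induction_on with
  | empty => simpa using ⟨mdifferentiableAt_const, mvfderiv_const (0 : ℝ)⟩
  | insert a s ha ih =>
    have ih := ih fun i hi ↦ h i (Finset.mem_insert_of_mem hi)
    have h1 := h a (Finset.mem_insert_self a s)
    simp only [Finset.sum_insert ha]
    exact ⟨h1.add ih.1, by rw [mvfderiv_fun_add h1 ih.1, ih.2]⟩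

end Calculus

/-! ### The metric connection of a Parseval family. -/

section ParsevalConnection

variable {m : ℕ} {M : Type*} [TopologicalSpace M]
  [ChartedSpace (EuclideanSpace ℝ (Fin m)) M] [IsManifold (𝓡 m) ∞ M]
  {g : Metric m M} {ι : Type*} {e : ι → VectorField m M}

variable (g e) in
/-- The derivative `∑ i, d(g (Y, e i)) ⊗ e i` of a vector field `Y`. -/
noncomputable def parsevalDeriv (Y : Π x : M, TangentSpace (𝓡 m) x) (x : M) :
    TangentSpace (𝓡 m) x →L[ℝ] TangentSpace (𝓡 m) x :=
  ∑ᶠ i, (mvfderiv (𝓡 m) (fun y ↦ g.inner y (Y y) (e i y)) x).smulRight (e i x)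

/-- Vanishing of `e i` at the single point `x` suffices, because `e i x` is a factor of the term
outside the derivative. -/
lemma parsevalDeriv_eq_sum (Y : Π x : M, TangentSpace (𝓡 m) x) {x : M} {s : Finset ι}
    (hs : ∀ i ∉ s, e i x = 0) :
    parsevalDeriv g e Y x =
      ∑ i ∈ s, (mvfderiv (𝓡 m) (fun y ↦ g.inner y (Y y) (e i y)) x).smulRight (e i x) := by
  refine finsum_eq_sum_of_support_subset _ fun i hi ↦ ?_
  by_contra h
  exact hi (by beta_reduce; rw [hs i h]; ext; simp)

lemma parsevalDeriv_apply (Y : Π x : M, TangentSpace (𝓡 m) x) {x : M} {s : Finset ι}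
    (hs : ∀ i ∉ s, e i x = 0) (v : TangentSpace (𝓡 m) x) :
    parsevalDeriv g e Y x v =
      ∑ i ∈ s, mvfderiv (𝓡 m) (fun y ↦ g.inner y (Y y) (e i y)) x v • e i x := by
  rw [parsevalDeriv_eq_sum Y hs]
  simp

lemma IsParseval.exists_finset (he : IsParseval g e) (x : M) :
    ∃ s : Finset ι, ∀ i ∉ s, e i x = 0 :=
  let ⟨s, hs⟩ := he.locallyFinite x
  ⟨s, hs.self_of_nhds⟩

variable (he : IsParseval g e)
include he

/-- In the Leibniz rule the product rule leaves `df ⊗ ∑ g(Y, e i) e i`, which is `df ⊗ Y` by the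
Parseval identity. -/
lemma IsParseval.isCovariantDerivativeOn :
    IsCovariantDerivativeOn (I := 𝓡 m) (EuclideanSpace ℝ (Fin m)) (parsevalDeriv g e) where
  add {Y Y' x} hY hY' _ := by
    obtain ⟨s, hs⟩ := he.exists_finset x
    refine ContinuousLinearMap.ext fun v ↦ ?_
    rw [add_apply, parsevalDeriv_apply _ hs, parsevalDeriv_apply _ hs, parsevalDeriv_apply _ hs,
      ← Finset.sum_add_distrib]
    refine Finset.sum_congr rfl fun i _ ↦ ?_
    rw [← add_smul, ← add_apply, ← mvfderiv_fun_add
      (mdifferentiableAt_inner g hY (e i).mdifferentiableAt)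
      (mdifferentiableAt_inner g hY' (e i).mdifferentiableAt)]
    simp
  leibniz {Y f x} hY hf _ := by
    obtain ⟨s, hs⟩ := he.exists_finset x
    refine ContinuousLinearMap.ext fun v ↦ ?_
    rw [add_apply, smul_apply, parsevalDeriv_apply _ hs, parsevalDeriv_apply _ hs,
      Finset.smul_sum, ContinuousLinearMap.smulRight_apply]
    conv_rhs => enter [2, 2]; rw [← he.sum_eq x s hs (Y x)]
    rw [Finset.smul_sum, ← Finset.sum_add_distrib]
    refine Finset.sum_congr rfl fun i _ ↦ ?_
    have : mvfderiv (𝓡 m) (fun y ↦ g.inner y ((f • Y) y) (e i y)) x =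
        mvfderiv (𝓡 m) (fun y ↦ f y * g.inner y (Y y) (e i y)) x := by
      congr 1
      ext y
      simp
    rw [this, mvfderiv_fun_mul hf (mdifferentiableAt_inner g hY (e i).mdifferentiableAt)]
    simp only [add_apply, smul_apply, smul_eq_mul, smul_smul, ← add_smul]
    congr 1
    ring

/-- The connection defined by a Parseval family of vector fields. -/
noncomputable def IsParseval.connection : Connection m M :=
  ⟨parsevalDeriv g e, he.isCovariantDerivativeOn⟩

lemma IsParseval.contMDiff_connection [SigmaCompactSpace M] [T2Space M] :
    CovariantDerivative.ContMDiffCovariantDerivative he.connection ∞ := by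
  refine ⟨⟨fun {Y} hY ↦ ?_⟩⟩
  have hY : Smooth Y := contMDiffOn_univ.1 hY
  refine (contMDiff_hom_of_apply (parsevalDeriv g e Y) fun X p ↦ ?_).contMDiffOn
  obtain ⟨s, hs⟩ := he.locallyFinite p
  have h1 : ContMDiff (𝓡 m) ((𝓡 m).prod 𝓘(ℝ, EuclideanSpace ℝ (Fin m))) ∞
      (fun x ↦ TotalSpace.mk' (EuclideanSpace ℝ (Fin m)) x
        (∑ i ∈ s, mvfderiv (𝓡 m) (fun y ↦ g.inner y (Y y) (e i y)) x (X x) • e i x)) :=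
    ContMDiff.sum_section fun i _ ↦ ContMDiff.smul_section
      (contMDiff_mvfderiv_apply (contMDiff_inner g hY (e i).contMDiff) X.contMDiff)
      (e i).contMDiff
  refine (h1 p).congr_of_eventuallyEq ?_
  filter_upwards [hs] with x hx
  rw [parsevalDeriv_apply _ hx]

/-- The Parseval identity gives `g(X, Y) = ∑ g(X, e i) g(Y, e i)`; differentiating each product
gives the two terms of duality. -/
lemma IsParseval.isSelfDual : IsSelfDual g he.connection := by
  intro X Y Z x
  obtain ⟨s, hs⟩ := he.locallyFinite x
  have hX (i) := mdifferentiableAt_inner g X.mdifferentiableAt (x := x) (e i).mdifferentiableAt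
  have hY (i) := mdifferentiableAt_inner g Y.mdifferentiableAt (x := x) (e i).mdifferentiableAt
  have h1 : (fun y ↦ g.inner y (X y) (Y y)) =ᶠ[𝓝 x]
      fun y ↦ ∑ i ∈ s, g.inner y (X y) (e i y) * g.inner y (Y y) (e i y) := by
    filter_upwards [hs] with y hy
    conv_lhs => rw [← he.sum_eq y s hy (X y)]
    simp [g.symm y (e _ y)]
  have hXY (i) : MDifferentiableAt (𝓡 m) 𝓘(ℝ)
      (fun y ↦ g.inner y (X y) (e i y) * g.inner y (Y y) (e i y)) x := (hX i).mul (hY i)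
  rw [mvfderiv_congr h1, (mvfderiv_finset_sum s fun i _ ↦ hXY i).2]
  change _ = g.inner x (parsevalDeriv g e X x (Z x)) (Y x) +
    g.inner x (X x) (parsevalDeriv g e Y x (Z x))
  rw [parsevalDeriv_apply _ hs.self_of_nhds, parsevalDeriv_apply _ hs.self_of_nhds]
  simp only [map_sum, sum_apply, ← Finset.sum_add_distrib]
  refine Finset.sum_congr rfl fun i _ ↦ ?_
  rw [mvfderiv_fun_mul (hX i) (hY i)]
  simp [g.symm x (e i x)]
  ring

/-- An isometry permuting the family is parallel. -/
lemma IsParseval.connection_comm {F : EndoField m M}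
    (hF : ∀ x v w, g.inner x (F x v) (F x w) = g.inner x v w)
    (σ : ι ≃ ι) (hσ : ∀ i, F.app (e i) = e (σ i)) (Y : VectorField m M) (x : M)
    (v : TangentSpace (𝓡 m) x) :
    he.connection (F.app Y) x v = F x (he.connection Y x v) := by
  obtain ⟨s, hs⟩ := he.exists_finset x
  change parsevalDeriv g e (F.app Y) x v = F x (parsevalDeriv g e Y x v)
  have hs' : ∀ i ∉ s.map σ.toEmbedding, e i x = 0 := fun i hi ↦ by
    obtain ⟨j, rfl⟩ := σ.surjective i
    rw [← hσ, EndoField.app_apply, hs j fun h ↦ hi (by simpa using h), map_zero]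
  -- After reindexing by `σ` the terms agree, since `g(F Y, e (σ i)) = g(F Y, F (e i)) = g(Y, e i)`.
  rw [parsevalDeriv_apply Y hs, parsevalDeriv_apply _ hs', Finset.sum_map, map_sum]
  refine Finset.sum_congr rfl fun i _ ↦ ?_
  simp [← hσ, hF]

end ParsevalConnection

/-! ### Linear algebra of almost contact metric structures. -/

section ContactData

variable {V : Type*} [AddCommGroup V] [Module ℝ V]

/-- The linear algebra of an almost contact metric structure. -/
structure ContactData (B : V →ₗ[ℝ] V →ₗ[ℝ] ℝ) (φ : V →ₗ[ℝ] V) (ξ : V) (η : V →ₗ[ℝ] ℝ) : Prop where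
  eta_xi : η ξ = 1
  phi_sq : ∀ v, φ (φ v) = -v + η v • ξ
  compatible : ∀ v w, B (φ v) (φ w) = B v w - η v * η w

namespace ContactData

variable {B : V →ₗ[ℝ] V →ₗ[ℝ] ℝ} {φ : V →ₗ[ℝ] V} {ξ : V} {η : V →ₗ[ℝ] ℝ}
  (H : ContactData B φ ξ η)
include H

/-- Since `φ² ξ = 0`, applying the formula for `φ²` to `φ ξ` shows that `φ ξ` is a multiple of `ξ`;
as `φ² ξ = 0`, the coefficient has square zero. -/
lemma phi_xi : φ ξ = 0 := by
  have h1 : φ (φ ξ) = 0 := by simp [H.phi_sq, H.eta_xi]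
  have h2 := H.phi_sq (φ ξ)
  rw [h1, map_zero] at h2
  have h3 : φ ξ = η (φ ξ) • ξ := by
    rw [eq_comm, neg_add_eq_zero] at h2; exact h2
  have h4 : (η (φ ξ) * η (φ ξ)) • ξ = 0 := by
    rw [mul_smul, ← h3, ← map_smul, ← h3, h1]
  have h5 : η (φ ξ) * η (φ ξ) = 0 := by
    simpa [H.eta_xi] using congrArg η h4
  rw [h3, mul_self_eq_zero.1 h5, zero_smul]

/-- Compare `φ²(φ v)` with `φ(φ² v)`. -/
lemma eta_phi (v : V) : η (φ v) = 0 := by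
  have h1 : φ (φ (φ v)) = -φ v := by
    rw [H.phi_sq v, map_add, map_neg, map_smul, H.phi_xi, smul_zero, add_zero]
  have h2 := congrArg η ((H.phi_sq (φ v)).symm.trans h1)
  simpa [H.eta_xi] using h2

lemma inner_xi (v : V) : B v ξ = η v := by
  have := H.compatible v ξ
  rw [H.phi_xi, map_zero, H.eta_xi] at this
  linarith

lemma xi_inner (v : V) : B ξ v = η v := by
  have := H.compatible ξ v
  rw [H.phi_xi, map_zero, H.eta_xi, LinearMap.zero_apply] at this
  linarith

lemma skew (v w : V) : B (φ v) w = -B v (φ w) := by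
  have h1 := H.compatible v (φ w)
  rw [H.phi_sq w, H.eta_phi, map_add, map_neg, map_smul, H.inner_xi, H.eta_phi] at h1
  simp at h1
  linarith

lemma isometry (v w : V) : B (φ v + η v • ξ) (φ w + η w • ξ) = B v w := by
  simp only [map_add, map_smul, LinearMap.add_apply, LinearMap.smul_apply, H.compatible,
    H.inner_xi, H.xi_inner, H.eta_phi, H.eta_xi, smul_eq_mul]
  ring

lemma iterate_two (v : V) :
    φ (φ v + η v • ξ) + η (φ v + η v • ξ) • ξ = -v + (2 * η v) • ξ := by
  simp only [map_add, map_smul, H.phi_sq, H.phi_xi, H.eta_phi, H.eta_xi, smul_eq_mul]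
  module

/-- `F²` is `-1` on `ker η` and `1` on `ξ`, hence an involution. -/
lemma iterate_four (v : V) :
    let F : V → V := fun v ↦ φ v + η v • ξ
    F (F (F (F v))) = v := by
  intro F
  have h (v : V) : F (F v) = -v + (2 * η v) • ξ := H.iterate_two v
  rw [h, h]
  simp only [map_add, map_neg, map_smul, H.eta_xi, smul_eq_mul]
  module

/-- With `F = φ + η ⊗ ξ` one has `η ⊗ ξ = (F² + 1)/2`. Thus `φ` is a polynomial in `F`, and is
parallel as soon as `F` is. -/
lemma phi_eq (v : V) : φ v = (φ v + η v • ξ) + ((-1 / 2 : ℝ) •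
    (φ (φ v + η v • ξ) + η (φ v + η v • ξ) • ξ) + (-1 / 2 : ℝ) • v) := by
  rw [H.iterate_two]
  module

lemma finrank_range [FiniteDimensional ℝ V] {k : ℕ} (hV : Module.finrank ℝ V = k + 1) :
    Module.finrank ℝ (LinearMap.range φ) = k := by
  have hξ : ξ ≠ 0 := fun h ↦ by simpa [h] using H.eta_xi
  have hker : LinearMap.ker φ = Submodule.span ℝ {ξ} := by
    refine le_antisymm (fun v hv ↦ ?_) ?_
    · have := H.phi_sq v
      rw [LinearMap.mem_ker.1 hv, map_zero, eq_comm, neg_add_eq_zero] at this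
      exact Submodule.mem_span_singleton.2 ⟨_, this.symm⟩
    · rw [Submodule.span_singleton_le_iff_mem]
      exact H.phi_xi
  have h1 := LinearMap.finrank_range_add_finrank_ker φ
  rw [hker, finrank_span_singleton hξ, hV] at h1
  omega

end ContactData
end ContactData

/-! ### From an almost contact metric structure to a connection. -/

section Forward

variable {m : ℕ} {M : Type*} [TopologicalSpace M]
  [ChartedSpace (EuclideanSpace ℝ (Fin m)) M] [IsManifold (𝓡 m) ∞ M]

lemma exists_isParseval_invariant [SigmaCompactSpace M] [T2Space M] (g : Metric m M)
    (F : EndoField m M) (hF : ∀ x v w, g.inner x (F x v) (F x w) = g.inner x v w)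
    (hF4 : ∀ x v, F x (F x (F x (F x v))) = v) :
    ∃ (e : (M × Fin m) × ZMod 4 → VectorField m M) (σ : (M × Fin m) × ZMod 4 ≃ _),
      IsParseval g e ∧ ∀ i, F.app (e i) = e (σ i) := by
  obtain ⟨e, he⟩ := exists_isParseval g
  have hF4' (X : VectorField m M) : F.app (F.app (F.app (F.app X))) = X :=
    VectorField.ext' fun x ↦ hF4 x (X x)
  -- Each of the four translates is again Parseval; the factor `1/2` enters squared and gives each
  -- the weight `1/4`.
  let e' : (M × Fin m) × ZMod 4 → VectorField m M := fun i ↦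
    (1 / 2 : ℝ) • (F.app^[i.2.val] (e i.1))
  have happ (n : ℕ) (X : VectorField m M) (x : M) :
      (F.app^[n] X) x = ((F x).toLinearMap ^ n) (X x) := by
    induction n generalizing X with
    | zero => rfl
    | succ n ih => rw [Function.iterate_succ_apply, ih, pow_succ]; rfl
  have hiso (n : ℕ) (x : M) (v w : TangentSpace (𝓡 m) x) :
      g.inner x (((F x).toLinearMap ^ n) v) (((F x).toLinearMap ^ n) w) = g.inner x v w := by
    induction n with
    | zero => rfl
    | succ n ih => rw [pow_succ']; exact (hF x _ _).trans ih
  have hsurj (n : ℕ) (x : M) : Function.Surjective ((F x).toLinearMap ^ n) := by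
    rw [Module.End.coe_pow]
    exact Function.Surjective.iterate (fun v ↦ ⟨_, hF4 x v⟩) n
  have he' (i x) : e' i x = (1 / 2 : ℝ) • ((F x).toLinearMap ^ i.2.val) (e i.1 x) := by
    rw [← happ]; rfl
  have he'0 {i} {x} (h : e i.1 x = 0) : e' i x = 0 := by
    rw [he', h, map_zero, smul_zero]
  refine ⟨e', (Equiv.refl _).prodCongr (Equiv.addRight 1), ⟨fun p ↦ ?_, fun x s hs v ↦ ?_⟩,
    fun i ↦ ?_⟩
  · obtain ⟨s, hs⟩ := he.locallyFinite p
    refine ⟨s ×ˢ Finset.univ, hs.mono fun y hy i hi ↦ he'0 (hy _ fun h ↦ hi (by simp [h]))⟩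
  · obtain ⟨t, ht⟩ := he.exists_finset x
    have h0 : ∑ i ∈ s, g.inner x v (e' i x) • e' i x =
        ∑ i ∈ t ×ˢ Finset.univ, g.inner x v (e' i x) • e' i x :=
      sum_eq_sum_of_forall_notMem (fun i hi ↦ by rw [hs i hi, smul_zero])
        fun i hi ↦ by rw [he'0 (ht _ fun h ↦ hi (by simp [h])), smul_zero]
    have h1 (k : ZMod 4) : ∑ i ∈ t, g.inner x v (e' (i, k) x) • e' (i, k) x = (1 / 4 : ℝ) • v := by
      obtain ⟨u, rfl⟩ := hsurj k.val x v
      conv_rhs => rw [← he.sum_eq x t ht u, map_sum, Finset.smul_sum]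
      refine Finset.sum_congr rfl fun i _ ↦ ?_
      rw [he', map_smul, map_smul, hiso, smul_smul, smul_smul]
      congr 1
      simp only [smul_eq_mul]
      ring
    rw [h0, Finset.sum_product_right]
    simp only [h1, Finset.sum_const, Finset.card_univ, ZMod.card, ← Nat.cast_smul_eq_nsmul ℝ,
      smul_smul]
    norm_num
  -- `F` shifts the `ZMod 4` index by one; the wrap from 3 to 0 is `F⁴ = 1`.
  · have hsucc (k : ZMod 4) (X : VectorField m M) :
        F.app^[(k + 1).val] X = F.app (F.app^[k.val] X) := by
      have hk := k.val_lt
      rw [← Function.iterate_succ_apply' F.app]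
      obtain h | h : k.val + 1 < 4 ∨ k.val = 3 := by omega
      · rw [ZMod.val_add_of_lt (by rw [ZMod.val_one'' (by norm_num)]; exact h),
          ZMod.val_one'' (by norm_num)]
      · have : k + 1 = 0 := by
          rw [← ZMod.natCast_zmod_val k, h]; rfl
        rw [this, h]
        exact (hF4' X).symm
    refine VectorField.ext' fun x ↦ ?_
    have h2 := DFunLike.congr_fun (hsucc i.2 (e i.1)) x
    rw [EndoField.app_apply]
    change F x ((1 / 2 : ℝ) • (F.app^[i.2.val] (e i.1)) x) =
      (1 / 2 : ℝ) • (F.app^[(i.2 + 1).val] (e i.1)) x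
    rw [h2, map_smul]
    rfl

lemma connection_add (D : Connection m M) (X Y : VectorField m M) (x : M) :
    D (X + Y : VectorField m M) x = D X x + D Y x :=
  D.isCovariantDerivativeOnUniv.add X.mdifferentiableAt Y.mdifferentiableAt

lemma connection_smul (D : Connection m M) (a : ℝ) (X : VectorField m M) (x : M) :
    D (a • X : VectorField m M) x = a • D X x :=
  D.isCovariantDerivativeOnUniv.smul_const a X.mdifferentiableAt

/-- An almost contact metric structure admits a parallelizing metric connection. -/
lemma MetricStructure.exists_connection [SigmaCompactSpace M] [T2Space M]
    (S : MetricStructure m M) :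
    ∃ D : Connection m M, CovariantDerivative.ContMDiffCovariantDerivative D ∞ ∧
      IsSelfDual S.g D ∧ GaugeEquation D D S.φ := by
  have H (x : M) : ContactData (S.g.bilin x) (S.φ x).toLinearMap (S.ξ x)
    (S.η x : TangentSpace (𝓡 m) x →L[ℝ] ℝ).toLinearMap :=
    ⟨S.eta_xi x, S.phi_sq x, S.compatible x⟩
  let F : EndoField m M := EndoField.ofApply
    (fun x ↦ S.φ x + (S.η x : TangentSpace (𝓡 m) x →L[ℝ] ℝ).smulRight (S.ξ x))
    fun X ↦ by
      have := (S.φ.app X + smulField _ (S.η.contMDiff_apply X) S.ξ).contMDiff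
      exact this
  have hF (x : M) (v : TangentSpace (𝓡 m) x) :
    F x v = S.φ x v + (S.η x v : ℝ) • S.ξ x := rfl
  obtain ⟨e, σ, he, hσ⟩ := exists_isParseval_invariant S.g F (fun x v w ↦ (H x).isometry v w)
    fun x v ↦ (H x).iterate_four v
  refine ⟨he.connection, he.contMDiff_connection, he.isSelfDual, fun X Y x ↦ ?_⟩
  have hφ : S.φ.app Y = F.app Y + ((-1 / 2 : ℝ) • F.app (F.app Y) + (-1 / 2 : ℝ) • Y) :=
    VectorField.ext' fun y ↦ (H y).phi_eq (Y y)
  have hcomm := he.connection_comm (fun x v w ↦ (H x).isometry v w) σ hσ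
  change he.connection (S.φ.app Y) x (X x) = _
  rw [hφ, connection_add, connection_add, connection_smul, connection_smul]
  simp only [add_apply, smul_apply, hcomm]
  exact ((H x).phi_eq _).symm

end Forward

/-! ### Odd polynomials in a skew-symmetric endomorphism. -/

section SkewPolynomial

open Polynomial

variable {V : Type*} [AddCommGroup V] [Module ℝ V] {B : V →ₗ[ℝ] V →ₗ[ℝ] ℝ} {θ : V →ₗ[ℝ] V}

/-- The odd polynomial `X f(-X²)`. -/
noncomputable def oddPoly (f : ℝ[X]) : ℝ[X] := X * f.comp (-X ^ 2)

lemma aeval_oddPoly_apply (f : ℝ[X]) (θ : V →ₗ[ℝ] V) (v : V) :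
    aeval θ (oddPoly f) v = θ (aeval (-θ ^ 2) f v) := by
  simp [oddPoly, aeval_comp]

lemma aeval_comm_apply (p q : ℝ[X]) (θ : V →ₗ[ℝ] V) (v : V) :
    aeval θ p (aeval θ q v) = aeval θ q (aeval θ p v) := by
  rw [← Module.End.mul_apply, ← Module.End.mul_apply, ← map_mul, ← map_mul, mul_comm]

lemma aeval_neg_sq_comm_apply (f : ℝ[X]) (θ : V →ₗ[ℝ] V) (v : V) :
    θ (aeval (-θ ^ 2) f v) = aeval (-θ ^ 2) f (θ v) := by
  have := aeval_comm_apply X (f.comp (-X ^ 2)) θ v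
  simpa [aeval_comp] using this

lemma inner_aeval_apply_of_symm {A : V →ₗ[ℝ] V} (hA : ∀ v w, B (A v) w = B v (A w)) (f : ℝ[X])
    (v w : V) : B (aeval A f v) w = B v (aeval A f w) := by
  induction f using Polynomial.induction_on' with
  | add p q hp hq => simp [hp, hq]
  | monomial k a =>
    have hk (v w : V) : B ((A ^ k) v) w = B v ((A ^ k) w) := by
      induction k generalizing v w with
      | zero => rfl
      | succ k ih => rw [pow_succ, Module.End.mul_apply, ih, hA, ← Module.End.mul_apply,
          ← pow_succ', ← pow_succ]
    simp [aeval_monomial, hk, Algebra.algebraMap_eq_smul_one]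

section

variable (hθ : ∀ v w, B (θ v) w = -B v (θ w))
include hθ

lemma inner_aeval_neg_sq_apply (f : ℝ[X]) (v w : V) :
    B (aeval (-θ ^ 2) f v) w = B v (aeval (-θ ^ 2) f w) :=
  inner_aeval_apply_of_symm (fun v w ↦ by simp [pow_two, hθ]) f v w

/-- Odd polynomials in a skew-symmetric endomorphism are skew-symmetric. -/
lemma skew_aeval_oddPoly (f : ℝ[X]) (v w : V) :
    B (aeval θ (oddPoly f) v) w = -B v (aeval θ (oddPoly f) w) := by
  rw [aeval_oddPoly_apply, aeval_oddPoly_apply, hθ, inner_aeval_neg_sq_apply hθ,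
    aeval_neg_sq_comm_apply]

end

/-- The odd polynomial `r + ... ` annihilating `θ` when `oddPoly f` applied to `θ` is a partial
complex structure with the same kernel as `θ`. -/
noncomputable def annihPoly (f : ℝ[X]) : ℝ[X] := oddPoly (1 - X * f ^ 2)

/-- The definition exhibits oddness, hence skewness at `θ`; this form shows that vanishing at `θ`
means `J² = -1` on the image of `θ`, for `J` the value of `oddPoly f`. -/
lemma annihPoly_eq (f : ℝ[X]) : annihPoly f = X + X * oddPoly f ^ 2 := by
  simp only [annihPoly, oddPoly, sub_comp, one_comp, mul_comp, X_comp, pow_comp]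
  ring

/-- The spectral theorem for the symmetric `-θ²` reduces the claim to eigenvectors. -/
lemma exists_aeval_annihPoly_eq_zero [FiniteDimensional ℝ V] (hs : ∀ v w, B v w = B w v)
    (hp : ∀ v, v ≠ 0 → 0 < B v v) (hθ : ∀ v w, B (θ v) w = -B v (θ w)) :
    ∃ f : ℝ[X], aeval θ (annihPoly f) = 0 := by
  let core : InnerProductSpace.Core ℝ V :=
    { inner := fun v w ↦ B v w
      conj_inner_symm := fun v w ↦ by simpa using hs w v
      re_inner_nonneg := fun v ↦ by
        by_cases h : v = 0
        · simp [h]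
        · simpa using (hp v h).le
      add_left := fun u v w ↦ by simp
      smul_left := fun v w r ↦ by simp
      definite := fun v h ↦ by
        by_contra h0
        exact (hp v h0).ne' h }
  let : NormedAddCommGroup V := core.toNormedAddCommGroup
  let : InnerProductSpace ℝ V := InnerProductSpace.ofCore core.toCore
  set A : V →ₗ[ℝ] V := -θ ^ 2 with hA
  have hAsymm : A.IsSymmetric := fun v w ↦ by
    change B (A v) w = B v (A w)
    simp [hA, pow_two, hθ]
  have htop := hAsymm.orthogonalComplement_iSup_eigenspaces_eq_bot
  rw [Submodule.orthogonal_eq_bot_iff] at htop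
  let s : Finset ℝ := (Module.End.finite_hasEigenvalue A).toFinset
  -- This makes `1 - μ f(μ)² = 0` at the positive eigenvalues. The value at `μ = 0` does not matter,
  -- since `θ` kills that eigenspace.
  let f : ℝ[X] := Lagrange.interpolate s id fun μ ↦ (Real.sqrt μ)⁻¹
  refine ⟨f, ?_⟩
  rw [← LinearMap.ker_eq_top, eq_top_iff, ← htop, iSup_le_iff]
  intro μ v hv
  rw [LinearMap.mem_ker]
  by_cases hv0 : v = 0
  · rw [hv0, map_zero]
  have hAv : A v = μ • v := Module.End.mem_eigenspace_iff.1 hv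
  have hev : Module.End.HasEigenvector A μ v := ⟨hv, hv0⟩
  have hθv : B (θ v) (θ v) = μ * B v v := by
    rw [hθ, ← smul_eq_mul, ← map_smul, ← hAv]
    simp [hA, pow_two]
  have hμs : μ ∈ s := by
    simpa [s] using Module.End.hasEigenvalue_of_hasEigenvector hev
  rw [annihPoly, aeval_oddPoly_apply, ← hA, Module.End.aeval_apply_of_hasEigenvector hev]
  obtain hμ | hμ := eq_or_ne μ 0
  · have : θ v = 0 := by
      by_contra h
      have := hp _ h
      rw [hθv, hμ] at this
      simp at this
    simp [this]
  · have hμ0 : 0 < μ := by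
      have h1 := hp v hv0
      have h2 : 0 ≤ B (θ v) (θ v) := by
        by_cases h : θ v = 0
        · simp [h]
        · exact (hp _ h).le
      rw [hθv] at h2
      exact lt_of_le_of_ne (nonneg_of_mul_nonneg_left h2 h1) hμ.symm
    have hf : f.eval μ = (Real.sqrt μ)⁻¹ :=
      Lagrange.eval_interpolate_at_node (v := id) _ Function.injective_id.injOn hμs
    have : (1 - X * f ^ 2 : ℝ[X]).eval μ = 0 := by
      simp [hf, Real.sq_sqrt hμ0.le, mul_inv_cancel₀ hμ]
    rw [this, zero_smul, map_zero]

/-- A skew-symmetric endomorphism is zero if the trace of its square vanishes. -/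
lemma eq_zero_of_sum_inner_sq {m : ℕ} (hp : ∀ v, v ≠ 0 → 0 < B v v) {T : V →ₗ[ℝ] V}
    (hT : ∀ v w, B (T v) w = -B v (T w)) {e : Fin m → V} (he : ∀ v, ∑ i, B v (e i) • e i = v)
    (h : ∑ i, B (T (T (e i))) (e i) = 0) : T = 0 := by
  have h0 (v : V) : 0 ≤ B v v := by
    by_cases h : v = 0
    · simp [h]
    · exact (hp _ h).le
  -- By skewness the trace of `T²` is minus a sum of squared norms.
  have h1 : ∑ i, B (T (e i)) (T (e i)) = 0 := by
    simpa [hT] using h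
  have h2 (i) : T (e i) = 0 := by
    by_contra hi
    have := (Finset.sum_eq_zero_iff_of_nonneg fun i _ ↦ h0 (T (e i))).1 h1 i (Finset.mem_univ i)
    exact (hp _ hi).ne' this
  refine LinearMap.ext fun v ↦ ?_
  rw [← he v, map_sum]
  simp [h2]

/-- The properties of the partial complex structure `oddPoly f` applied to `θ`. -/
lemma comp_sq_of_annihPoly {f : ℝ[X]} (h : aeval θ (annihPoly f) = 0) (v : V) :
    θ (aeval θ (oddPoly f) (aeval θ (oddPoly f) v)) = -θ v := by
  have := LinearMap.congr_fun h v
  rw [annihPoly_eq] at this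
  simp [pow_two] at this
  rw [eq_neg_iff_add_eq_zero, add_comm]
  exact this

/-- Writing `J = f(-θ²) θ`, the relation `θ J² = -θ` gives `J³ = -f(-θ²) θ = -J`. -/
lemma cube_of_annihPoly {f : ℝ[X]} (h : aeval θ (annihPoly f) = 0) (v : V) :
    aeval θ (oddPoly f) (aeval θ (oddPoly f) (aeval θ (oddPoly f) v)) =
      -aeval θ (oddPoly f) v := by
  conv_lhs => rw [aeval_oddPoly_apply, aeval_neg_sq_comm_apply, comp_sq_of_annihPoly h]
  rw [aeval_oddPoly_apply, aeval_neg_sq_comm_apply, map_neg]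

lemma aeval_oddPoly_eq_zero_of_apply_eq_zero {f : ℝ[X]} {v : V} (hv : θ v = 0) :
    aeval θ (oddPoly f) v = 0 := by
  rw [aeval_oddPoly_apply, aeval_neg_sq_comm_apply, hv, map_zero]

end SkewPolynomial

/-! ### The orientation defined by a complex structure. -/

section Orientation

variable {n : ℕ}

-- The block matrix is the real form of `A + iB`, so its determinant is `|det (A + iB)|²`.
open Matrix in
lemma det_fromBlocks_nonneg (A B : Matrix (Fin n) (Fin n) ℝ) :
    0 ≤ (fromBlocks A (-B) B A).det := by
  let a : Matrix (Fin n) (Fin n) ℂ := A.map (algebraMap ℝ ℂ)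
  let b : Matrix (Fin n) (Fin n) ℂ := B.map (algebraMap ℝ ℂ)
  have h1 : (algebraMap ℝ ℂ) (fromBlocks A (-B) B A).det = (fromBlocks a (-b) b a).det := by
    rw [RingHom.map_det]
    congr 1
    ext i j
    rcases i with i | i <;> rcases j with j | j <;> simp [a, b]
  have h2 : fromBlocks 1 (Complex.I • 1) 0 1 * fromBlocks a (-b) b a *
      fromBlocks 1 (-Complex.I • 1) 0 1 =
      fromBlocks (a + Complex.I • b) 0 b (a - Complex.I • b) := by
    simp only [fromBlocks_multiply]
    congr 1 <;> simp [smul_smul, sub_eq_add_neg]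
    · abel
    · abel
  have h3 : (fromBlocks a (-b) b a).det = (a + Complex.I • b).det * (a - Complex.I • b).det := by
    have := congrArg det h2
    simpa [det_mul, det_fromBlocks_zero₂₁, det_fromBlocks_zero₁₂] using this
  have h4 : (a - Complex.I • b).det = (starRingEnd ℂ) (a + Complex.I • b).det := by
    rw [RingHom.map_det]
    congr 1
    ext i j
    simp [a, b, sub_eq_add_neg]
  rw [h4, Complex.mul_conj] at h3
  have h5 := h1.trans h3
  have h6 : (fromBlocks A (-B) B A).det = Complex.normSq (a + Complex.I • b).det := by
    exact Complex.ofReal_injective h5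
  rw [h6]
  exact Complex.normSq_nonneg _

variable {V : Type*} [AddCommGroup V] [Module ℝ V]

/-- The family `v, u₁, …, uₙ, φ u₁, …, φ uₙ`. -/
def adaptedFamily (φ : V →ₗ[ℝ] V) (v : V) (u : Fin n → V) : Unit ⊕ (Fin n ⊕ Fin n) → V :=
  Sum.elim (fun _ ↦ v) (Sum.elim u (φ ∘ u))

variable {φ : V →ₗ[ℝ] V} {v : V} (hv : φ v = 0) (hφ : ∀ w, φ (φ w) + w ∈ Submodule.span ℝ {v})
include hφ

include hv in
/-- All bases adapted to `φ` with the same first vector define the same orientation. -/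
lemma det_adaptedFamily_mul_nonneg (b : Module.Basis (Unit ⊕ (Fin n ⊕ Fin n)) ℝ V)
    (u u' : Fin n → V) :
    0 ≤ b.det (adaptedFamily φ v u) * b.det (adaptedFamily φ v u') := by
  by_cases h : b.det (adaptedFamily φ v u) = 0
  · simp [h]
  obtain ⟨hli, hspan⟩ := (b.is_basis_iff_det).2 (isUnit_iff_ne_zero.2 h)
  let c := Module.Basis.mk hli hspan.ge
  have hc : ⇑c = adaptedFamily φ v u := Module.Basis.coe_mk ..
  have h1 : b.det (adaptedFamily φ v u') =
      b.det (adaptedFamily φ v u) * c.det (adaptedFamily φ v u') := by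
    conv_lhs => rw [AlternatingMap.eq_smul_basis_det c b.det]
    rw [hc]; rfl
  rw [h1, ← mul_assoc]
  refine mul_nonneg (mul_self_nonneg _) ?_
  have hcv : c (Sum.inl ()) = v := by rw [hc]; rfl
  have hcu (k) : c (Sum.inr (Sum.inl k)) = u k := by rw [hc]; rfl
  have hcφ (k) : c (Sum.inr (Sum.inr k)) = φ (u k) := by rw [hc]; rfl
  let A : Matrix (Fin n) (Fin n) ℝ := fun j k ↦ c.repr (u' k) (Sum.inr (Sum.inl j))
  let C : Matrix (Fin n) (Fin n) ℝ := fun j k ↦ c.repr (u' k) (Sum.inr (Sum.inr j))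
  have hu' (k) : u' k = c.repr (u' k) (Sum.inl ()) • v +
      (∑ j, A j k • u j + ∑ j, C j k • φ (u j)) := by
    conv_lhs => rw [← c.sum_repr (u' k), Fintype.sum_sum_type, Fintype.sum_sum_type]
    simp only [Finset.univ_unique, Finset.sum_singleton, hcu, hcφ]
    rw [← hcv]
  have hφφ (j) : ∃ a : ℝ, φ (φ (u j)) = -u j + a • v := by
    obtain ⟨a, ha⟩ := Submodule.mem_span_singleton.1 (hφ (u j))
    exact ⟨a, by rw [ha]; abel⟩
  choose a ha using hφφ
  have hφu' (k) : φ (u' k) = (∑ j, A j k • φ (u j) + ∑ j, C j k • (-u j + a j • v)) := by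
    conv_lhs => rw [hu' k]
    simp [hv, ha]
  have hrv : c.repr v = Finsupp.single (Sum.inl ()) 1 := by rw [← hcv, c.repr_self]
  have hru (j) : c.repr (u j) = Finsupp.single (Sum.inr (Sum.inl j)) 1 := by
    rw [← hcu, c.repr_self]
  have hrφ (j) : c.repr (φ (u j)) = Finsupp.single (Sum.inr (Sum.inr j)) 1 := by
    rw [← hcφ, c.repr_self]
  -- Modulo `v`, the change of basis commutes with `φ`, so it is complex linear and has the block
  -- form with nonnegative determinant.
  have hM : c.toMatrix (adaptedFamily φ v u') = Matrix.fromBlocks 1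
      (Matrix.of fun _ j ↦ c.repr (Sum.elim u' (φ ∘ u') j) (Sum.inl ())) 0
      (Matrix.fromBlocks A (-C) C A) := by
    ext i j
    rw [Module.Basis.toMatrix_apply]
    rcases i with i | i | i <;> rcases j with j | j | j
    · change c.repr v (Sum.inl ()) = _
      simp [hrv]
    · rfl
    · rfl
    · change c.repr v _ = 0
      simp [hrv]
    · rfl
    · change c.repr (φ (u' j)) _ = -C i j
      simp [hφu', hru, hrφ, hrv, Finsupp.single_apply]
    · change c.repr v _ = 0
      simp [hrv]
    · rfl
    · change c.repr (φ (u' j)) _ = A i j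
      simp [hφu', hru, hrφ, hrv, Finsupp.single_apply]
  rw [Module.Basis.det_apply, hM, Matrix.det_fromBlocks_zero₂₁, Matrix.det_one, one_mul]
  exact det_fromBlocks_nonneg A C

/-- There is a basis adapted to `φ` with any first vector. -/
lemma exists_linearIndependent_adaptedFamily [FiniteDimensional ℝ V]
    (hV : Module.finrank ℝ V = 2 * n + 1) (hv0 : v ≠ 0) (hv : φ v = 0) :
    ∃ u : Fin n → V, LinearIndependent ℝ (adaptedFamily φ v u) := by
  let L := Submodule.span ℝ {v}
  have hL : L ≤ L.comap φ := by
    rw [Submodule.span_singleton_le_iff_mem, Submodule.mem_comap, hv]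
    exact L.zero_mem
  -- `J` makes the quotient a complex vector space of dimension `n`; the `u k` lift a complex basis
  -- `b`, and `b`, `J b` together form a real basis.
  let J : Module.End ℝ (V ⧸ L) := L.mapQ L φ hL
  have hJ : J * J = -1 := by
    refine LinearMap.ext fun w ↦ ?_
    obtain ⟨w, rfl⟩ := L.mkQ_surjective w
    have h0 : L.mkQ (φ (φ w) + w) = 0 := (Submodule.Quotient.mk_eq_zero L).2 (hφ w)
    rw [map_add] at h0
    exact eq_neg_of_add_eq_zero_left h0
  let ψ : ℂ →ₐ[ℝ] Module.End ℝ (V ⧸ L) := Complex.lift ⟨J, hJ⟩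
  let : Module ℂ (V ⧸ L) := Module.compHom (V ⧸ L) ψ.toRingHom
  have hsmul (z : ℂ) (w : V ⧸ L) : z • w = ψ z w := rfl
  have : IsScalarTower ℝ ℂ (V ⧸ L) := ⟨fun r z w ↦ by simp [hsmul]⟩
  have : Module.Finite ℂ (V ⧸ L) := Module.Finite.of_restrictScalars_finite ℝ ℂ (V ⧸ L)
  have hrank : Module.finrank ℂ (V ⧸ L) = n := by
    have h1 := Module.finrank_mul_finrank ℝ ℂ (V ⧸ L)
    have h2 := L.finrank_quotient_add_finrank
    rw [finrank_span_singleton hv0, hV] at h2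
    rw [Complex.finrank_real_complex] at h1
    omega
  let b := (Module.finBasisOfFinrankEq ℂ (V ⧸ L) hrank)
  choose u hu using fun k ↦ L.mkQ_surjective (b k)
  refine ⟨u, ?_⟩
  let c := Complex.basisOneI.smulTower b
  have hli : LinearIndependent ℝ (Submodule.Quotient.mk (p := L) ∘ Sum.elim u (φ ∘ u)) := by
    have h1 := c.linearIndependent.comp
      (Sum.elim (fun k : Fin n ↦ ((0 : Fin 2), k)) fun k ↦ (1, k)) (by
        rintro (i | i) (j | j) h <;> simp_all)
    convert h1 using 1
    ext k
    rcases k with k | k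
    · simp [c, ← hu]
    · simp [c, ← hu, hsmul, ψ, J]
  have hvL : LinearIndependent ℝ (fun _ : Unit ↦ (⟨v, Submodule.mem_span_singleton_self v⟩ : L)) :=
    linearIndependent_unique_iff.2 fun h ↦ hv0 (congrArg Subtype.val h)
  exact hvL.sumElim_of_quotient (Sum.elim u (φ ∘ u)) hli

end Orientation

/-! ### Parallel fields of endomorphisms and their traces. -/

section Parallel

open Polynomial

variable {m : ℕ} {M : Type*} [TopologicalSpace M]
  [ChartedSpace (EuclideanSpace ℝ (Fin m)) M]

/-- A smooth function with vanishing derivative is locally constant. -/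
lemma eventually_eq_of_mvfderiv_eq_zero [IsManifold (𝓡 m) ∞ M] {f : M → ℝ} {p : M}
    (hf : ∀ᶠ x in 𝓝 p, MDifferentiableAt (𝓡 m) 𝓘(ℝ) f x)
    (h : ∀ᶠ x in 𝓝 p, mvfderiv (𝓡 m) f x = 0) : ∀ᶠ x in 𝓝 p, f x = f p := by
  let c := extChartAt (𝓡 m) p
  have hsymm : Filter.Tendsto c.symm (𝓝 (c p)) (𝓝 p) := by
    have := (continuousAt_extChartAt_symm (I := 𝓡 m) p).tendsto
    rwa [extChartAt_to_inv] at this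
  have hev := (hsymm.eventually (hf.and h)).and (extChartAt_target_mem_nhds (I := 𝓡 m) p)
  obtain ⟨r, hr, hball⟩ := Metric.eventually_nhds_iff_ball.1 hev
  have hd : ∀ y ∈ Metric.ball (c p) r, HasFDerivAt (f ∘ c.symm) (0 : _ →L[ℝ] ℝ) y := by
    intro y hy
    obtain ⟨⟨h1, h2⟩, h3⟩ := hball y hy
    have h4 : MDifferentiableAt 𝓘(ℝ, EuclideanSpace ℝ (Fin m)) (𝓡 m) c.symm y :=
      ((contMDiffOn_extChartAt_symm (n := ∞) (I := 𝓡 m) p).contMDiffAt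
        ((isOpen_extChartAt_target (I := 𝓡 m) p).mem_nhds h3)).mdifferentiableAt (by simp)
    have h5 : HasMFDerivAt (𝓡 m) 𝓘(ℝ) f (c.symm y) 0 := by
      have h6 : mfderiv (𝓡 m) 𝓘(ℝ) f (c.symm y) = 0 := h2
      rw [← h6]
      exact h1.hasMFDerivAt
    have h7 := h5.comp y h4.hasMFDerivAt
    rw [ContinuousLinearMap.zero_comp] at h7
    exact h7.hasFDerivAt
  have hconst : ∀ y ∈ Metric.ball (c p) r, (f ∘ c.symm) y = (f ∘ c.symm) (c p) := by
    intro y hy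
    exact Metric.isOpen_ball.is_const_of_fderiv_eq_zero (convex_ball _ _).isPreconnected
      (fun z hz ↦ (hd z hz).differentiableAt.differentiableWithinAt)
      (fun z hz ↦ (hd z hz).fderiv) hy (Metric.mem_ball_self hr)
  have hcont : ContinuousAt c p := continuousAt_extChartAt (I := 𝓡 m) p
  filter_upwards [hcont (Metric.ball_mem_nhds _ hr), extChartAt_source_mem_nhds (I := 𝓡 m) p]
    with x hx hxs
  have h8 : c.symm (c x) = x := (extChartAt (𝓡 m) p).left_inv hxs
  have h9 : c.symm (c p) = p := extChartAt_to_inv p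
  have h10 : f (c.symm (c x)) = f (c.symm (c p)) := hconst (c x) hx
  rwa [h8, h9] at h10

variable [IsManifold (𝓡 m) ∞ M]

/-- The action of a field of endomorphisms on vector fields. -/
noncomputable def EndoField.toEnd (θ : EndoField m M) : Module.End ℝ (VectorField m M) where
  toFun := θ.app
  map_add' X Y := VectorField.ext' fun x ↦ map_add (θ x) (X x) (Y x)
  map_smul' a X := VectorField.ext' fun x ↦ map_smul (θ x) a (X x)

lemma EndoField.aeval_toEnd_apply (θ : EndoField m M) (q : ℝ[X]) (X : VectorField m M) (x : M) :
    (aeval θ.toEnd q X) x = aeval (θ x).toLinearMap q (X x) := by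
  induction q using Polynomial.induction_on' with
  | add p q hp hq =>
    rw [aeval_add, aeval_add, LinearMap.add_apply, LinearMap.add_apply, ← hp, ← hq]
    rfl
  | monomial k a =>
    have hk : (θ.toEnd ^ k) X x = ((θ x).toLinearMap ^ k) (X x) := by
      induction k with
      | zero => rfl
      | succ k ih =>
        rw [pow_succ', pow_succ', Module.End.mul_apply, Module.End.mul_apply, ← ih]
        rfl
    simp only [aeval_monomial, Algebra.algebraMap_eq_smul_one, smul_mul_assoc, one_mul,
      LinearMap.smul_apply, ← hk]
    rfl

lemma OrthonormalAt.trace_eq {g : Metric m M} {E : Fin m → VectorField m M} {x : M}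
    (hE : OrthonormalAt g E x)
    (T : TangentSpace (𝓡 m) x →ₗ[ℝ] TangentSpace (𝓡 m) x) :
    LinearMap.trace ℝ _ T = ∑ j, g.inner x (T (E j x)) (E j x) := by
  have h : T = ∑ j, ((g.bilin x).flip (E j x) ∘ₗ T).smulRight (E j x) := by
    refine LinearMap.ext fun v ↦ ?_
    conv_lhs => rw [← hE.sum_eq (T v)]
    simp
  conv_lhs => rw [h]
  rw [map_sum]
  refine Finset.sum_congr rfl fun j _ ↦ ?_
  simp

variable [SigmaCompactSpace M] [T2Space M] {g : Metric m M} {D : Connection m M}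
  {θ : EndoField m M}

lemma GaugeEquation.apply (hθ : GaugeEquation D D θ) (Y : VectorField m M) (x : M)
    (v : TangentSpace (𝓡 m) x) : D (θ.app Y) x v = θ x (D Y x v) := by
  obtain ⟨X, rfl⟩ := exists_vectorField_apply_eq x v
  exact hθ X Y x

lemma IsSelfDual.apply (hD : IsSelfDual g D) (X Y : VectorField m M) (x : M)
    (v : TangentSpace (𝓡 m) x) :
    mvfderiv (𝓡 m) (fun y ↦ g.inner y (X y) (Y y)) x v =
      g.inner x (D X x v) (Y x) + g.inner x (X x) (D Y x v) := by
  obtain ⟨Z, rfl⟩ := exists_vectorField_apply_eq x v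
  exact hD X Y Z x

/-- Polynomials in a parallel field of endomorphisms are parallel. -/
lemma GaugeEquation.aeval (hθ : GaugeEquation D D θ) (q : ℝ[X]) (Y : VectorField m M) (x : M)
    (v : TangentSpace (𝓡 m) x) :
    D (aeval θ.toEnd q Y) x v = aeval (θ x).toLinearMap q (D Y x v) := by
  induction q using Polynomial.induction_on' with
  | add p q hp hq =>
    rw [Polynomial.aeval_add, Polynomial.aeval_add, LinearMap.add_apply, LinearMap.add_apply,
      ← hp, ← hq]
    rw [connection_add, add_apply]
  | monomial k a =>
    have hk : D ((θ.toEnd ^ k) Y) x v = ((θ x).toLinearMap ^ k) (D Y x v) := by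
      induction k with
      | zero => rfl
      | succ k ih =>
        rw [pow_succ', pow_succ', Module.End.mul_apply, Module.End.mul_apply, ← ih]
        exact hθ.apply _ x v
    simp only [aeval_monomial, Algebra.algebraMap_eq_smul_one, smul_mul_assoc, one_mul,
      LinearMap.smul_apply, ← hk, connection_smul, smul_apply]

/-- The traces of polynomials in a parallel field of endomorphisms are locally constant. -/
lemma GaugeEquation.isLocallyConstant_trace (hD : IsSelfDual g D) (hθ : GaugeEquation D D θ)
    (q : ℝ[X]) :
    IsLocallyConstant fun x ↦ LinearMap.trace ℝ _ (Polynomial.aeval (θ x).toLinearMap q) := by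
  rw [IsLocallyConstant.iff_eventually_eq]
  intro p
  obtain ⟨E, hE⟩ := exists_orthonormalAt g p
  let QE (j : Fin m) : VectorField m M := Polynomial.aeval θ.toEnd q (E j)
  let N : M → ℝ := fun x ↦ ∑ j, g.inner x (QE j x) (E j x)
  have hN : ∀ x, OrthonormalAt g E x →
      LinearMap.trace ℝ _ (Polynomial.aeval (θ x).toLinearMap q) = N x := fun x hx ↦ by
    rw [hx.trace_eq]
    simp only [N, QE, EndoField.aeval_toEnd_apply]
  have hd (j) (x) := (contMDiff_inner g (QE j).contMDiff (E j).contMDiff x).mdifferentiableAt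
    (by simp)
  have hconst : ∀ᶠ x in 𝓝 p, N x = N p := by
    refine eventually_eq_of_mvfderiv_eq_zero
      (Filter.Eventually.of_forall fun x ↦ (mvfderiv_finset_sum _ fun j _ ↦ hd j x).1) ?_
    filter_upwards [hE.eventually_nhds] with x hx
    refine ContinuousLinearMap.ext fun v ↦ ?_
    have hE' := hx.self_of_nhds
    rw [(mvfderiv_finset_sum _ fun j _ ↦ hd j x).2, sum_apply, zero_apply]
    -- The connection coefficients `a` are antisymmetric because the frame stays orthonormal. The
    -- derivative of the trace is `∑ a i j (b j i + b i j)`, an antisymmetric array paired with a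
    -- symmetric one.
    let a (i j : Fin m) : ℝ := g.inner x (D (E i) x v) (E j x)
    let b (i j : Fin m) : ℝ := g.inner x (QE i x) (E j x)
    have ha (i j) : a i j = -a j i := by
      have h1 := hD.apply (E i) (E j) x v
      have h2 : (fun y ↦ g.inner y (E i y) (E j y)) =ᶠ[𝓝 x]
          fun _ ↦ (if i = j then (1 : ℝ) else 0) := hx.mono fun y hy ↦ hy i j
      rw [mvfderiv_congr h2, mvfderiv_const, zero_apply, g.symm x (E i x)] at h1
      simp only [a]
      linarith
    have hDE (i) : D (E i) x v = ∑ j, a i j • E j x := (hE'.sum_eq _).symm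
    have h1 (i) : mvfderiv (𝓡 m) (fun y ↦ g.inner y (QE i y) (E i y)) x v =
        ∑ j, a i j * b j i + ∑ j, a i j * b i j := by
      rw [hD.apply, hθ.aeval, hDE]
      simp only [map_sum, map_smul, sum_apply, smul_apply, smul_eq_mul, b, QE,
        EndoField.aeval_toEnd_apply]
    simp only [h1, Finset.sum_add_distrib]
    rw [Finset.sum_comm, ← Finset.sum_add_distrib]
    refine Finset.sum_eq_zero fun i _ ↦ ?_
    rw [← Finset.sum_add_distrib]
    refine Finset.sum_eq_zero fun j _ ↦ ?_
    rw [ha j i]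
    ring
  filter_upwards [hE, hconst] with x hx hx'
  rw [hN x hx, hN p hE.self_of_nhds, hx']

end Parallel

/-! ### The partial complex structure of a parallel skew field. -/

section ComplexStructure

open Polynomial

variable {m : ℕ} {M : Type*} [TopologicalSpace M]
  [ChartedSpace (EuclideanSpace ℝ (Fin m)) M] [IsManifold (𝓡 m) ∞ M]
  [SigmaCompactSpace M] [T2Space M] {g : Metric m M} {D : Connection m M} {θ : EndoField m M}

/-- The value of the odd `annihPoly f` at `θ x` is skew, so the trace of its square is minus its
squared Hilbert–Schmidt norm. This turns a polynomial identity into a locally constant condition. -/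
lemma aeval_annihPoly_eq_zero_iff_trace (hs : IsSkew g θ) (f : ℝ[X]) (x : M) :
    aeval (θ x).toLinearMap (annihPoly f) = 0 ↔
      LinearMap.trace ℝ _ (aeval (θ x).toLinearMap (annihPoly f ^ 2)) = 0 := by
  constructor
  · intro h
    rw [map_pow, h]
    simp
  · intro h
    obtain ⟨E, hE⟩ := exists_orthonormalAt g x
    have hE := hE.self_of_nhds
    rw [hE.trace_eq] at h
    refine eq_zero_of_sum_inner_sq (B := g.bilin x) (e := fun i ↦ E i x)
      (fun v hv ↦ g.pos x v hv) (fun v w ↦ skew_aeval_oddPoly (hs x) _ v w) hE.sum_eq ?_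
    rw [← h, map_pow, pow_two]
    rfl

/-- Two points of the same connected component satisfy the same polynomial identities. -/
lemma GaugeEquation.aeval_annihPoly_congr (hD : IsSelfDual g D) (hθ : GaugeEquation D D θ)
    (hs : IsSkew g θ) {x y : M} (hxy : x ∈ connectedComponent y) {f : ℝ[X]}
    (h : Polynomial.aeval (θ y).toLinearMap (annihPoly f) = 0) :
    Polynomial.aeval (θ x).toLinearMap (annihPoly f) = 0 := by
  rw [aeval_annihPoly_eq_zero_iff_trace hs] at h ⊢
  rw [← h]
  exact (hθ.isLocallyConstant_trace hD _).apply_eq_of_isPreconnected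
    isPreconnected_connectedComponent hxy mem_connectedComponent

lemma GaugeEquation.exists_annihPoly (hD : IsSelfDual g D) (hθ : GaugeEquation D D θ)
    (hs : IsSkew g θ) : ∃ f : M → ℝ[X], (∀ p, ∀ᶠ x in 𝓝 p, f x = f p) ∧
      ∀ x, Polynomial.aeval (θ x).toLinearMap (annihPoly (f x)) = 0 := by
  have h (x : M) : ∃ f, Polynomial.aeval (θ x).toLinearMap (annihPoly f) = 0 :=
    exists_aeval_annihPoly_eq_zero (B := g.bilin x) (g.symm x) (g.pos x) (hs x)
  choose F hF using h
  have : LocallyConnectedSpace M :=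
    ChartedSpace.locallyConnectedSpace (EuclideanSpace ℝ (Fin m)) M
  -- One polynomial per component, chosen at a representative; components are open, so the choice is
  -- locally constant.
  let r (x : M) : M := (ConnectedComponents.mk x).out
  have hr (x : M) : ConnectedComponents.mk (r x) = ConnectedComponents.mk x := Quotient.out_eq _
  refine ⟨fun x ↦ F (r x), fun p ↦ ?_, fun x ↦ ?_⟩
  · filter_upwards [isOpen_connectedComponent.mem_nhds mem_connectedComponent] with x hx
    have : ConnectedComponents.mk x = ConnectedComponents.mk p :=
      ConnectedComponents.coe_eq_coe'.2 hx
    simp only [r, this]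
  · exact hθ.aeval_annihPoly_congr hD hs (ConnectedComponents.coe_eq_coe'.1 (hr x).symm) (hF _)

/-- A parallel skew-symmetric field of endomorphisms `θ` gives rise to a partial complex structure
on the image of `θ`. -/
lemma GaugeEquation.exists_endoField (hD : IsSelfDual g D) (hθ : GaugeEquation D D θ)
    (hs : IsSkew g θ) : ∃ φ : EndoField m M, IsSkew g φ ∧
      ∀ x (v : TangentSpace (𝓡 m) x), θ x (φ x (φ x v)) = -θ x v ∧
        φ x (φ x (φ x v)) = -φ x v ∧ (θ x v = 0 → φ x v = 0) := by
  obtain ⟨f, hf, hf0⟩ := hθ.exists_annihPoly hD hs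
  have (x : M) : T2Space (TangentSpace (𝓡 m) x) :=
    inferInstanceAs (T2Space (EuclideanSpace ℝ (Fin m)))
  let A (x : M) : TangentSpace (𝓡 m) x →L[ℝ] TangentSpace (𝓡 m) x :=
    LinearMap.toContinuousLinearMap (Polynomial.aeval (θ x).toLinearMap (oddPoly (f x)))
  have hA (X : VectorField m M) : Smooth (fun x ↦ A x (X x)) := by
    intro p
    refine (Polynomial.aeval θ.toEnd (oddPoly (f p)) X).contMDiff.contMDiffAt
      |>.congr_of_eventuallyEq ?_
    filter_upwards [hf p] with x hx
    congr 1
    rw [EndoField.aeval_toEnd_apply, ← hx]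
    rfl
  refine ⟨EndoField.ofApply A hA, fun x v w ↦ ?_, fun x v ↦ ⟨?_, ?_, ?_⟩⟩
  · exact skew_aeval_oddPoly (B := g.bilin x) (hs x) (f x) v w
  · exact comp_sq_of_annihPoly (hf0 x) v
  · exact cube_of_annihPoly (hf0 x) v
  · exact aeval_oddPoly_eq_zero_of_apply_eq_zero

end ComplexStructure

/-! ### The positive half-line in the kernel. -/

section PositiveKernel

variable {n : ℕ} {V : Type*} [AddCommGroup V] [Module ℝ V]

/-- The vectors in the kernel of `φ` which, completed by a basis of the form `u, φ u`, are
positively oriented with respect to the basis `b`. -/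
def positiveKernel (b : Module.Basis (Unit ⊕ (Fin n ⊕ Fin n)) ℝ V) (φ : V →ₗ[ℝ] V) : Set V :=
  {v | φ v = 0 ∧ ∃ u : Fin n → V, 0 < b.det (adaptedFamily φ v u)}

variable {b : Module.Basis (Unit ⊕ (Fin n ⊕ Fin n)) ℝ V} {φ : V →ₗ[ℝ] V}

lemma det_adaptedFamily_smul (a : ℝ) (v : V) (u : Fin n → V) :
    b.det (adaptedFamily φ (a • v) u) = a * b.det (adaptedFamily φ v u) := by
  have h (w : V) : adaptedFamily φ w u =
      Function.update (adaptedFamily φ v u) (Sum.inl ()) w := by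
    funext i
    rcases i with i | i
    · simp [adaptedFamily]
    · rw [Function.update_of_ne (by simp)]
      rfl
  rw [h (a • v), AlternatingMap.map_update_smul, ← h v, smul_eq_mul]

lemma smul_mem_positiveKernel {a : ℝ} (ha : 0 < a) {v : V} (hv : v ∈ positiveKernel b φ) :
    a • v ∈ positiveKernel b φ := by
  obtain ⟨h, u, hu⟩ := hv
  exact ⟨by rw [map_smul, h, smul_zero], u, by rw [det_adaptedFamily_smul]; positivity⟩

lemma ne_zero_of_mem_positiveKernel {v : V} (hv : v ∈ positiveKernel b φ) : v ≠ 0 := by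
  rintro rfl
  obtain ⟨-, u, hu⟩ := hv
  rw [← zero_smul ℝ (0 : V), det_adaptedFamily_smul, zero_mul] at hu
  exact hu.false

variable (h3 : ∀ v, φ (φ (φ v)) = -φ v) (h1 : Module.finrank ℝ (LinearMap.ker φ) = 1)
include h3 h1

lemma add_comp_self_mem_span {v : V} (hv0 : v ≠ 0) (hv : φ v = 0) (w : V) :
    φ (φ w) + w ∈ Submodule.span ℝ {v} := by
  have hw : φ (φ w) + w ∈ LinearMap.ker φ := by
    rw [LinearMap.mem_ker, map_add, h3, neg_add_cancel]
  obtain ⟨c, hc⟩ := (finrank_eq_one_iff_of_nonzero' (⟨v, hv⟩ : LinearMap.ker φ)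
    (fun h ↦ hv0 (congrArg Subtype.val h))).1 h1 ⟨_, hw⟩
  exact Submodule.mem_span_singleton.2 ⟨c, congrArg Subtype.val hc⟩

/-- A nonzero kernel vector extends to an adapted basis; if its determinant is negative, the
opposite vector is positive. -/
lemma exists_mem_positiveKernel (b : Module.Basis (Unit ⊕ (Fin n ⊕ Fin n)) ℝ V) :
    (positiveKernel b φ).Nonempty := by
  obtain ⟨⟨v, hv⟩, hv0, -⟩ := finrank_eq_one_iff'.1 h1
  have hv0 : v ≠ 0 := fun h ↦ hv0 (Subtype.ext h)
  have : FiniteDimensional ℝ V := b.finiteDimensional_of_finite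
  have hV : Module.finrank ℝ V = 2 * n + 1 := by
    rw [Module.finrank_eq_card_basis b]
    simp
    omega
  obtain ⟨u, hu⟩ := exists_linearIndependent_adaptedFamily
    (add_comp_self_mem_span h3 h1 hv0 hv) hV hv0 hv
  have hdet : b.det (adaptedFamily φ v u) ≠ 0 := by
    refine isUnit_iff_ne_zero.1 (b.is_basis_iff_det.1 ⟨hu, ?_⟩)
    exact hu.span_eq_top_of_card_eq_finrank' (by rw [Module.finrank_eq_card_basis b])
  rcases hdet.lt_or_gt with h | h
  · refine ⟨(-1 : ℝ) • v, by rw [map_smul, LinearMap.mem_ker.1 hv, smul_zero], u, ?_⟩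
    rw [det_adaptedFamily_smul]
    linarith
  · exact ⟨v, hv, u, h⟩

/-- The kernel is a line, so `w = a • v`, and by `det_adaptedFamily_mul_nonneg` the sign of the
determinant does not depend on `u`. -/
lemma exists_eq_smul_of_mem_positiveKernel {v w : V} (hv : v ∈ positiveKernel b φ)
    (hw : w ∈ positiveKernel b φ) : ∃ a : ℝ, 0 < a ∧ w = a • v := by
  have hv0 := ne_zero_of_mem_positiveKernel hv
  obtain ⟨hv1, u, hu⟩ := hv
  obtain ⟨hw1, u', hu'⟩ := hw
  obtain ⟨a, ha⟩ := Submodule.mem_span_singleton.1 (add_comp_self_mem_span h3 h1 hv0 hv1 w)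
  rw [hw1, map_zero, zero_add] at ha
  refine ⟨a, ?_, ha.symm⟩
  rw [← ha, det_adaptedFamily_smul] at hu'
  have h := det_adaptedFamily_mul_nonneg hv1 (add_comp_self_mem_span h3 h1 hv0 hv1) b u u'
  have h' := nonneg_of_mul_nonneg_right h hu
  exact pos_of_mul_pos_left hu' h'

lemma convex_positiveKernel : Convex ℝ (positiveKernel b φ) := by
  intro v hv w hw s t hs ht hst
  obtain ⟨a, ha, rfl⟩ := exists_eq_smul_of_mem_positiveKernel h3 h1 hv hw
  rw [smul_smul, ← add_smul]
  refine smul_mem_positiveKernel ?_ hv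
  rcases hs.eq_or_lt with rfl | hs
  · rw [zero_add] at hst
    rw [hst]
    linarith
  · positivity

end PositiveKernel

/-! ### Oriented atlases and positive families of fields. -/

section Orientation

variable {m : ℕ} {M : Type*} [TopologicalSpace M]
  [ChartedSpace (EuclideanSpace ℝ (Fin m)) M]
  {e e' : OpenPartialHomeomorph M (EuclideanSpace ℝ (Fin m))}

lemma mdifferentiable_of_mem_maximalAtlas (he : e ∈ IsManifold.maximalAtlas (𝓡 m) ∞ M) :
    e.MDifferentiable (𝓡 m) (𝓡 m) :=
  ⟨(contMDiffOn_of_mem_maximalAtlas he).mdifferentiableOn (by simp),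
    (contMDiffOn_symm_of_mem_maximalAtlas he).mdifferentiableOn (by simp)⟩

lemma mfderiv_eq_fderiv_comp_mfderiv (he : e ∈ IsManifold.maximalAtlas (𝓡 m) ∞ M)
    (he' : e' ∈ IsManifold.maximalAtlas (𝓡 m) ∞ M) {x : M} (hx : x ∈ e.source)
    (hx' : x ∈ e'.source) (v : TangentSpace (𝓡 m) x) :
    mfderiv (𝓡 m) (𝓡 m) e' x v =
      fderiv ℝ (e.symm.trans e') (e x) (mfderiv (𝓡 m) (𝓡 m) e x v) := by
  have h1 := (mdifferentiable_of_mem_maximalAtlas he).mdifferentiableAt hx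
  have h2 : MDifferentiableAt (𝓡 m) (𝓡 m) (e.symm.trans e') (e x) := by
    have h3 := (mdifferentiable_of_mem_maximalAtlas he).mdifferentiableAt_symm (e.map_source hx)
    have h4 := (mdifferentiable_of_mem_maximalAtlas he').mdifferentiableAt hx'
    rw [← e.left_inv hx] at h4
    exact h4.comp _ h3
  have h5 := mfderiv_comp x h2 h1
  have h6 : (e.symm.trans e') ∘ e =ᶠ[𝓝 x] e' := by
    filter_upwards [e.open_source.mem_nhds hx] with y hy
    simp [e.left_inv hy]
  rw [h6.mfderiv_eq, mfderiv_eq_fderiv] at h5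
  exact DFunLike.congr_fun h5 v

variable [IsManifold (𝓡 m) ∞ M]

/-- An orientation in terms of positively oriented families of tangent vectors. -/
lemma Orientable.exists_positive (hM : Orientable m M)
    {ι : Type*} [Fintype ι] [DecidableEq ι]
    (hι : Fintype.card ι = m) : ∃ P : Π x : M, (ι → TangentSpace (𝓡 m) x) → Prop,
      (∀ x, ∃ b : Module.Basis ι ℝ (TangentSpace (𝓡 m) x), ∀ w, P x w ↔ 0 < b.det w) ∧
      ∀ (W : ι → VectorField m M) (p : M), P p (fun i ↦ W i p) →
        ∀ᶠ x in 𝓝 p, P x (fun i ↦ W i x) := by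
  obtain ⟨A, hA, hcov, hdet⟩ := hM
  let b₀ : Module.Basis ι ℝ (EuclideanSpace ℝ (Fin m)) :=
    (EuclideanSpace.basisFun (Fin m) ℝ).toBasis.reindex (Fintype.equivOfCardEq (by simp [hι]))
  let d (e : OpenPartialHomeomorph M (EuclideanSpace ℝ (Fin m))) (x : M)
    (w : ι → TangentSpace (𝓡 m) x) : ℝ := b₀.det (fun i ↦ mfderiv (𝓡 m) (𝓡 m) e x (w i))
  -- Positivity does not depend on the chart: the determinants differ by the positive Jacobian of
  -- the transition map.
  have hd {e e'} (he : e ∈ A) (he' : e' ∈ A) {x : M} (hx : x ∈ e.source) (hx' : x ∈ e'.source)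
      (w : ι → TangentSpace (𝓡 m) x) (h : 0 < d e x w) : 0 < d e' x w := by
    have h1 : d e' x w = (fderiv ℝ (e.symm.trans e') (e x)).det * d e x w := by
      simp only [d, mfderiv_eq_fderiv_comp_mfderiv (hA he) (hA he') hx hx']
      exact b₀.det_comp (fderiv ℝ (e.symm.trans e') (e x)).toLinearMap _
    rw [h1]
    refine mul_pos (hdet e he e' he' _ ?_) h
    simp [hx, hx', e.left_inv hx]
  refine ⟨fun x w ↦ ∃ e ∈ A, x ∈ e.source ∧ 0 < d e x w, fun x ↦ ?_, ?_⟩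
  · obtain ⟨e, he, hx⟩ := hcov x
    let L : TangentSpace (𝓡 m) x ≃L[ℝ] EuclideanSpace ℝ (Fin m) :=
      (mdifferentiable_of_mem_maximalAtlas (hA he)).mfderiv hx
    refine ⟨b₀.map L.toLinearEquiv.symm, fun w ↦ ?_⟩
    rw [Module.Basis.det_map]
    exact ⟨fun ⟨e', he', hx', h⟩ ↦ hd he' he hx' hx w h, fun h ↦ ⟨e, he, hx, h⟩⟩
  · rintro W p ⟨e, he, hp, h⟩
    have hc (i) : ContinuousAt (fun x ↦ (mfderiv (𝓡 m) (𝓡 m) e x (W i x) :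
        EuclideanSpace ℝ (Fin m))) p := by
      have h1 := (contMDiffOn_of_mem_maximalAtlas (hA he)).continuousOn_tangentMapWithin (by simp)
        e.open_source.uniqueMDiffOn
      have h2 : ContinuousOn (fun x ↦ tangentMapWithin (𝓡 m) (𝓡 m) e e.source
          (TotalSpace.mk' (EuclideanSpace ℝ (Fin m)) x (W i x))) e.source :=
        h1.comp (W i).contMDiff.continuous.continuousOn fun x hx ↦ hx
      have h3 := (contMDiff_snd_tangentBundle_modelSpace (n := 0) (EuclideanSpace ℝ (Fin m))
        (𝓡 m)).continuous.comp_continuousOn h2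
      refine (h3.continuousAt (e.open_source.mem_nhds hp)).congr ?_
      filter_upwards [e.open_source.mem_nhds hp] with x hx
      change mfderivWithin (𝓡 m) (𝓡 m) e e.source x (W i x) = _
      rw [mfderivWithin_of_isOpen e.open_source hx]
    have hcd : ContinuousAt (fun x ↦ d e x fun i ↦ W i x) p := by
      have hdet : Continuous (fun N : Matrix ι ι ℝ ↦ N.det) := continuous_id.matrix_det
      refine (hdet.continuousAt (x := b₀.toMatrix _)).comp
        (f := fun x ↦ b₀.toMatrix fun i ↦ (mfderiv (𝓡 m) (𝓡 m) e x (W i x) :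
          EuclideanSpace ℝ (Fin m))) ?_
      refine continuousAt_pi.2 fun i ↦ continuousAt_pi.2 fun j ↦ ?_
      exact ((b₀.coord i).continuous_of_finiteDimensional.continuousAt).comp (hc j)
    filter_upwards [hcd.eventually (lt_mem_nhds h), e.open_source.mem_nhds hp] with x hx hxe
    exact ⟨e, he, hxe, hx⟩

end Orientation

/-! ### Construction of the almost contact metric structure. -/

section Backward

/-- A nowhere vanishing vector field can be normalized. -/
lemma exists_vectorField_unit {m : ℕ} {M : Type*} [TopologicalSpace M]
    [ChartedSpace (EuclideanSpace ℝ (Fin m)) M] [IsManifold (𝓡 m) ∞ M] (g : Metric m M)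
    (ξ : VectorField m M) (hξ : ∀ x, ξ x ≠ 0) :
    ∃ ζ : VectorField m M, ∀ x, g.inner x (ζ x) (ζ x) = 1 ∧ ∃ a : ℝ, ζ x = a • ξ x := by
  let f : M → ℝ := fun x ↦ g.inner x (ξ x) (ξ x)
  have hf0 (x : M) : 0 < f x := g.pos x _ (hξ x)
  have hf : ContMDiff (𝓡 m) 𝓘(ℝ) ∞ f := contMDiff_inner g ξ.contMDiff ξ.contMDiff
  have hs : ContMDiff (𝓡 m) 𝓘(ℝ) ∞ (fun x ↦ (Real.sqrt (f x))⁻¹) := fun x ↦ by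
    have h1 : ContDiffAt ℝ ∞ (fun y ↦ (Real.sqrt y)⁻¹) (f x) :=
      (Real.contDiffAt_sqrt (hf0 x).ne').inv (Real.sqrt_pos.2 (hf0 x)).ne'
    exact h1.contMDiffAt.comp x hf.contMDiffAt
  refine ⟨smulField _ hs ξ, fun x ↦ ⟨?_, _, rfl⟩⟩
  have h1 : 0 < g.inner x (ξ x) (ξ x) := hf0 x
  have h2 : Real.sqrt (g.inner x (ξ x) (ξ x)) ≠ 0 := (Real.sqrt_pos.2 h1).ne'
  simp only [smulField_apply, map_smul, smul_apply, smul_eq_mul, f]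
  field_simp
  rw [Real.sq_sqrt h1.le]

variable {n : ℕ} {M : Type*} [TopologicalSpace M]
  [ChartedSpace (EuclideanSpace ℝ (Fin (2 * n + 1))) M] [IsManifold (𝓡 (2 * n + 1)) ∞ M]
  [SigmaCompactSpace M] [T2Space M] {φ : EndoField (2 * n + 1) M}

/-- On an orientable manifold, the kernel of a partial complex structure of corank one is spanned
by a nowhere vanishing vector field. -/
lemma Orientable.exists_vectorField_ker (hM : Orientable (2 * n + 1) M)
    (h3 : ∀ x v, φ x (φ x (φ x v)) = -φ x v)
    (h1 : ∀ x, Module.finrank ℝ (LinearMap.ker (φ x).toLinearMap) = 1) :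
    ∃ ξ : VectorField (2 * n + 1) M, ∀ x, ξ x ≠ 0 ∧ φ x (ξ x) = 0 := by
  obtain ⟨P, hPb, hP⟩ := hM.exists_positive (ι := Unit ⊕ (Fin n ⊕ Fin n)) (by simp; omega)
  choose b hb using hPb
  obtain ⟨ξ, hξ⟩ := exists_contMDiffSection_forall_mem_convex_of_local (n := ⊤) (𝓡 (2 * n + 1))
    (fun x : M ↦ TangentSpace (𝓡 (2 * n + 1)) x)
    (fun x ↦ positiveKernel (b x) (φ x).toLinearMap)
    (fun x ↦ convex_positiveKernel (h3 x) (h1 x))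
    (fun p ↦ by
      obtain ⟨v, hv, u, hu⟩ := exists_mem_positiveKernel (h3 p) (h1 p) (b p)
      have hv : φ p v = 0 := hv
      obtain ⟨X, rfl⟩ := exists_vectorField_apply_eq p v
      choose U hU using fun k ↦ exists_vectorField_apply_eq (m := 2 * n + 1) p (u k)
      -- Since `φ³ = -φ`, the operator `1 + φ²` maps into `ker φ` everywhere and fixes `v` at `p`.
      -- Positivity at `p` then persists nearby.
      let V : VectorField (2 * n + 1) M := X + φ.app (φ.app X)
      have hV (x : M) : V x = X x + φ x (φ x (X x)) := rfl
      let W : Unit ⊕ (Fin n ⊕ Fin n) → VectorField (2 * n + 1) M :=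
        Sum.elim (fun _ ↦ V) (Sum.elim U fun k ↦ φ.app (U k))
      have hW (x : M) : (fun i ↦ W i x) =
          adaptedFamily (φ x).toLinearMap (V x) (fun k ↦ U k x) := by
        funext i
        rcases i with i | i | i <;> rfl
      have hp : P p (fun i ↦ W i p) := by
        rw [hW, hb, hV, hv, map_zero, add_zero]
        simpa only [hU] using hu
      refine ⟨{x | P x (fun i ↦ W i x)}, hP W p hp, V, V.contMDiff.contMDiffOn, fun x hx ↦ ?_⟩
      refine ⟨?_, fun k ↦ U k x, ?_⟩
      · change φ x (V x) = 0
        rw [hV, map_add, h3, add_neg_cancel]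
      · rw [← hb, ← hW]
        exact hx)
  exact ⟨ξ, fun x ↦ ⟨ne_zero_of_mem_positiveKernel (hξ x), (hξ x).1⟩⟩

/-- A skew-symmetric partial complex structure of corank one on an orientable Riemannian manifold
is part of an almost contact metric structure. -/
lemma Orientable.nonempty_metricStructure (hM : Orientable (2 * n + 1) M)
    {g : Metric (2 * n + 1) M} (hs : IsSkew g φ)
    (h3 : ∀ x v, φ x (φ x (φ x v)) = -φ x v)
    (h1 : ∀ x, Module.finrank ℝ (LinearMap.ker (φ x).toLinearMap) = 1) :
    Nonempty (MetricStructure (2 * n + 1) M) := by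
  obtain ⟨ξ₀, hξ₀⟩ := hM.exists_vectorField_ker h3 h1
  obtain ⟨ξ, hξ⟩ := exists_vectorField_unit g ξ₀ fun x ↦ (hξ₀ x).1
  have hφξ (x : M) : φ x (ξ x) = 0 := by
    obtain ⟨a, ha⟩ := (hξ x).2
    rw [ha, map_smul, (hξ₀ x).2, smul_zero]
  have hξ0 (x : M) : ξ x ≠ 0 := fun h ↦ by
    have := (hξ x).1
    rw [h, map_zero] at this
    exact zero_ne_one this
  have hsq (x : M) (v : TangentSpace (𝓡 (2 * n + 1)) x) :
      φ x (φ x v) = -v + g.inner x (ξ x) v • ξ x := by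
    obtain ⟨a, ha⟩ := Submodule.mem_span_singleton.1
      (add_comp_self_mem_span (φ := (φ x).toLinearMap) (h3 x) (h1 x) (hξ0 x) (hφξ x) v)
    have ha : a • ξ x = φ x (φ x v) + v := ha
    -- Pairing with `ξ` identifies `a`: the term `g(ξ, φ² v)` vanishes by skewness and `φ ξ = 0`.
    have h2 : g.inner x (ξ x) (a • ξ x) = g.inner x (ξ x) v := by
      rw [ha, map_add]
      have := hs x (ξ x) (φ x v)
      rw [hφξ, map_zero, zero_apply] at this
      linarith
    rw [map_smul, (hξ x).1, smul_eq_mul, mul_one] at h2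
    rw [← h2, ha]
    abel
  exact ⟨{
    φ := φ
    ξ := ξ
    η := OneForm.ofInner g ξ
    g := g
    eta_xi := fun x ↦ (hξ x).1
    phi_sq := hsq
    compatible := fun x v w ↦ by
      rw [hs, hsq, map_add, map_neg, map_smul, g.symm x v (ξ x), smul_eq_mul]
      simp only [OneForm.ofInner_apply]
      ring }⟩

end Backward

end AlmostContact


/-! ### The equivalence. -/

theorem mainTheorem3 (n : ℕ) (M : Type*) [TopologicalSpace M] [T2Space M]
    [SecondCountableTopology M]
    [ChartedSpace (EuclideanSpace ℝ (Fin (2 * n + 1))) M] [IsManifold (𝓡 (2 * n + 1)) ∞ M]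
    (hM : AlmostContact.Orientable (2 * n + 1) M) :
    Nonempty (AlmostContact.MetricStructure (2 * n + 1) M) ↔
      ∃ (g : AlmostContact.Metric (2 * n + 1) M) (D : AlmostContact.Connection (2 * n + 1) M)
        (θ : AlmostContact.EndoField (2 * n + 1) M),
        CovariantDerivative.ContMDiffCovariantDerivative D ∞ ∧
        AlmostContact.IsSelfDual g D ∧
        AlmostContact.GaugeEquation D D θ ∧
        AlmostContact.IsSkew g θ ∧
        AlmostContact.HasRank θ (2 * n) := by
  have : LocallyCompactSpace M :=
    ChartedSpace.locallyCompactSpace (EuclideanSpace ℝ (Fin (2 * n + 1))) M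
  constructor
  · rintro ⟨S⟩
    obtain ⟨D, hD, hsd, hg⟩ := S.exists_connection
    have H (x : M) : AlmostContact.ContactData (S.g.bilin x) (S.φ x).toLinearMap (S.ξ x)
        (S.η x : TangentSpace (𝓡 (2 * n + 1)) x →L[ℝ] ℝ).toLinearMap :=
      ⟨S.eta_xi x, S.phi_sq x, S.compatible x⟩
    exact ⟨S.g, D, S.φ, hD, hsd, hg, fun x ↦ (H x).skew, fun x ↦
      (H x).finrank_range (AlmostContact.finrank_tangentSpace x)⟩
  · rintro ⟨g, D, θ, -, hsd, hg, hs, hr⟩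
    obtain ⟨φ, hφs, hφ⟩ := hg.exists_endoField hsd hs
    refine hM.nonempty_metricStructure hφs (fun x v ↦ (hφ x v).2.1) fun x ↦ ?_
    -- If `φ v = 0`, then `θ φ² v = -θ v` forces `θ v = 0`, so the rank of `θ` makes `ker φ` a line.
    have hker : LinearMap.ker (φ x).toLinearMap = LinearMap.ker (θ x).toLinearMap := by
      refine le_antisymm (fun v hv ↦ ?_) fun v hv ↦ (hφ x v).2.2 hv
      have hv : φ x v = 0 := hv
      have h := (hφ x v).1
      rw [hv, map_zero, map_zero] at h
      exact neg_eq_zero.1 h.symm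
    have h := LinearMap.finrank_range_add_finrank_ker (θ x).toLinearMap
    rw [AlmostContact.finrank_tangentSpace, hr x] at h
    rw [hker]
    omega
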